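/- \textbf{Setting.} Let $n\ge 1$ and let $\Lambda=\mathrm{diag}(\lambda_1,\dots,\lambda_n)$ be a complex matrix with all $\lambda_j\neq 0$. Put $\beta_0=1$ and, for $r\ge 1$, $$\beta_r=\min_{1\le j\le n}\ \min_{k\in\mathbb{Z}_{\ge 0}^n,\ |k|=r+1}\bigl|\lambda^{k}\lambda_j^{-1}-1\bigr|,\qquad \alpha_r=\min_{0\le s\le r}\beta_s ,$$ where $\lambda^k=\lambda_1^{k_1}\cdots\lambda_n^{k_n}$ and $|k|=k_1+\dots+k_n$. The eigenvalues are non-resonant if $\beta_r\ne 0$ for all $r\ge 1$, and they satisfy Condition $\tau$ if $$\Gamma:=-\sum_{r\ge 1}\frac{\ln\alpha_r}{r(r+1)}<\infty .$$ For a polynomial vector field $X=(X_1,\dots,X_n)$ on $\mathbb{C}^n$ let $\|X\|$ be the sum of the absolute values of all coefficients of all components $X_j$. Let $$x'=f(x)=\Lambda x+v_1(x)+v_2(x)+\cdots$$ be an analytic map defined near the fixed point $0\in\mathbb{C}^n$, where each component of $v_s$ is a homogeneous polynomial of degree $s+1$ and the series converges in a neighbourhood of the origin. \textbf{Theorem.}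 For all real $A>0$ and $C_0\ge 0$ there is a constant $B=B(A,C_0)>0$, depending only on $A$ and $C_0$ (in particular independent of the dimension $n$ and, for given $A$ and $C_0$, of the eigenvalues $\lambda$), with the following property. Let $f$ be a map as above, in any dimension $n\ge1$, whose eigenvalues are non-resonant and satisfy Condition $\tau$. Then there are constants $A>0$ and $C_0\ge 0$ with $$\|\Lambda^{-1}v_s\|\le A\,C_0^{\,s-1}\qquad\text{for all } s\ge 1, \tag{1}$$ and for every pair $A>0$, $C_0\ge 0$ satisfying (1) there is a near-identity transformation $y=x+\psi(x)$, with $\psi(0)=0$ and $D\psi(0)=0$, such that (i) $\psi$ is analytic on (a neighbourhood of) the closed polydisk $\{x\in\mathbb{C}^n: |x_j|\le B^{-1}e^{-\Gamma},\ j=1,\dots,n\}$; (ii) the transformation conjugates the map to its linear part $y'=\Lambda y$, that is, $f(x)+\psi(f(x))=\Lambda\bigl(x+\psi(x)\bigr)$ for all $x$ in a neighbourhood of the origin. Consequently the supremum $\varrho\in(0,\infty]$ of the radii of the polydisks centred at the origin on which $\psi$ is analytic satisfies $\ln\varrho\ge-\Gamma+C'$ with $C'=-\ln B$; that is, the estimate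 $\ln\varrho\ge -C\,\Gamma+C'$ holds with $C=1$ in any dimension. -/

import Mathlib

open Filter Topology
open scoped ENNReal NNReal

namespace SchroederSiegel

noncomputable section

/-- The sequence of smallest divisors: `β₀ = 1` and, for `r ≥ 1`, `β_r` is the minimum over the
multi-indices `k ∈ ℕⁿ` with `|k| = r + 1` and over `j` of `|λ^k λ_j⁻¹ - 1|`. If
`λ_j = exp (μ_j + i ω_j)`, then `λ^k λ_j⁻¹ = exp (⟨k, μ + i ω⟩ - μ_j - i ω_j)`. For `1 ≤ n` the
infimum is over a finite non-empty family, so it is a minimum. -/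
def beta {n : ℕ} (lam : Fin n → ℂ) (r : ℕ) : ℝ :=
  if r = 0 then 1
  else ⨅ p : {k : Fin n → ℕ // ∑ i, k i = r + 1} × Fin n,
    ‖(∏ i, lam i ^ p.1.1 i) * (lam p.2)⁻¹ - 1‖

/-- The eigenvalues are non-resonant: `β_r ≠ 0` for all `r ≥ 1`. -/
def NonResonant {n : ℕ} (lam : Fin n → ℂ) : Prop :=
  ∀ r : ℕ, 1 ≤ r → beta lam r ≠ 0

/-- `α_r = min_{0 ≤ s ≤ r} β_s`. -/
def alpha {n : ℕ} (lam : Fin n → ℂ) (r : ℕ) : ℝ :=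
  (Finset.range (r + 1)).inf' Finset.nonempty_range_add_one (beta lam)

/-- Condition τ with value `Γ`: the series `∑_{r ≥ 1} - ln α_r / (r (r + 1))` converges to the
real number `Γ`. -/
def ConditionTau {n : ℕ} (lam : Fin n → ℂ) (Γ : ℝ) : Prop :=
  HasSum (fun r : ℕ => -Real.log (alpha lam (r + 1)) / (((r : ℝ) + 1) * ((r : ℝ) + 2))) Γ

/-- The polynomial norm of a polynomial vector field: the sum of the absolute values of all the
coefficients of all the components. -/
def polyNorm {n : ℕ} (X : Fin n → MvPolynomial (Fin n) ℂ) : ℝ :=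
  ∑ j, ∑ k ∈ (X j).support, ‖(X j).coeff k‖

/-- The vector field `Λ⁻¹ X` with `Λ = diag(λ₁, …, λ_n)`. -/
def invLinear {n : ℕ} (lam : Fin n → ℂ) (X : Fin n → MvPolynomial (Fin n) ℂ) :
    Fin n → MvPolynomial (Fin n) ℂ :=
  fun j => MvPolynomial.C (lam j)⁻¹ * X j

/-- Near the origin `f` is an analytic map with the expansion
`f x = Λ x + v₁(x) + v₂(x) + …`, where `v_s` is a homogeneous polynomial vector field of degree
`s + 1` (the entry `v 0` is not used). -/
structure IsMapExpansion {n : ℕ} (lam : Fin n → ℂ)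
    (v : ℕ → Fin n → MvPolynomial (Fin n) ℂ) (f : (Fin n → ℂ) → (Fin n → ℂ)) : Prop where
  analyticAt : AnalyticAt ℂ f 0
  homogeneous : ∀ s : ℕ, 1 ≤ s → ∀ j, (v s j).IsHomogeneous (s + 1)
  hasSum : ∀ᶠ x in 𝓝 (0 : Fin n → ℂ), ∀ j,
    HasSum (fun s : ℕ => MvPolynomial.eval x (v (s + 1) j)) (f x j - lam j * x j)

/-- The nonlinearity has size `(A, C₀)`: `‖Λ⁻¹ v_s‖ ≤ A C₀^(s-1)` for all `s ≥ 1`, where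
`x' = Λ (x + Λ⁻¹ v₁(x) + Λ⁻¹ v₂(x) + …)`. -/
def NonlinearBound {n : ℕ} (lam : Fin n → ℂ) (v : ℕ → Fin n → MvPolynomial (Fin n) ℂ)
    (A C₀ : ℝ) : Prop :=
  ∀ s : ℕ, 1 ≤ s → polyNorm (invLinear lam (v s)) ≤ A * C₀ ^ (s - 1)

/-- The closed polydisk of radius `ρ` around the origin of `ℂⁿ`. -/
def polydisk (n : ℕ) (ρ : ℝ) : Set (Fin n → ℂ) :=
  {x | ∀ j, ‖x j‖ ≤ ρ}

/-- The supremum of the radii of the polydisks on which `ψ` is analytic (possibly infinite). -/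
def analyticRadius {n : ℕ} (ψ : (Fin n → ℂ) → (Fin n → ℂ)) : ℝ≥0∞ :=
  ⨆ (ρ : ℝ≥0) (_ : AnalyticOnNhd ℂ ψ (polydisk n ρ)), (ρ : ℝ≥0∞)

end

end SchroederSiegel

/-! The linear normal form is reached one degree at a time. If `F = Λ(id + v)` with `v` of order `m
= r + 1`, the homological equation `Λ⁻¹ U(Λx) = U - v_m` is solved for the degree-`m` part `v_m`,
and conjugation by `id + U` raises the order by one (`exists_step`). All sizes are weighted `ℓ¹`
norms of coefficients, taken separately for each component. These norms are submultiplicative and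
compose well without counting monomials, so the dimension never enters.

The constant `C = 1` comes from using each divisor economically. If `v` has relative size `ηα_r`,
then `U` has relative size `η`. The new nonlinearity is still of size about `ηα_r`, because the
terms involving `U` occur in it only through a difference proportional to `v`. Before the next step
the polydisk is therefore shrunk only enough to turn `α_r` into `α_{r+1}`. A series of order `r + 2`
gains `q^{r+1}` in relative size when the radius is multiplied by `q`, so `-ln q` is `(ln α_r - ln
α_{r+1})/(r+1)` plus `O(1/r²)`. Abel summation of the first terms gives a total of at most `Γ`
(`lossExp_succ_sub`, `lossExp_le`), and the second terms cost an absolute constant (`le_radius`).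

The composed transformations stay bounded on a polydisk of radius proportional to `e^{-Γ}` and
converge formally (`exists_formal_linearization`). A formal series of finite norm is analytic there,
and formal composition becomes genuine composition near the origin (`analyticOnNhd_evalAt`,
`evalAt_subst`). -/

namespace SchroederSiegel

open MvPowerSeries Finset

/-! ### Orders of formal power series and substitution -/

/-- The ideal of formal power series without terms of degree less than `m`. -/
def orderIdeal (σ : Type*) (m : ℕ) : Ideal (MvPowerSeries σ ℂ) where
  carrier := {g | ∀ k : σ →₀ ℕ, k.degree < m → coeff k g = 0}
  zero_mem' := fun k _ => by simp
  add_mem' := fun {a b} ha hb k hk => by simp [ha k hk, hb k hk]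
  smul_mem' := fun c g hg k hk => by
    classical
    rw [smul_eq_mul, coeff_mul]
    refine Finset.sum_eq_zero fun p hp => ?_
    rw [HasAntidiagonal.mem_antidiagonal] at hp
    rw [hg p.2 (lt_of_le_of_lt _ hk), mul_zero]
    rw [← hp, map_add]
    exact Nat.le_add_left _ _

section

variable {σ : Type*}

theorem orderIdeal_anti {m p : ℕ} (h : m ≤ p) : orderIdeal σ p ≤ orderIdeal σ m :=
  fun _ hg k hk => hg k (hk.trans_le h)

theorem mem_orderIdeal_zero (g : MvPowerSeries σ ℂ) : g ∈ orderIdeal σ 0 :=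
  fun _ hk => absurd hk (Nat.not_lt_zero _)

theorem mul_mem_orderIdeal {m p : ℕ} {f g : MvPowerSeries σ ℂ} (hf : f ∈ orderIdeal σ m)
    (hg : g ∈ orderIdeal σ p) : f * g ∈ orderIdeal σ (m + p) := by
  classical
  intro k hk
  rw [coeff_mul]
  refine Finset.sum_eq_zero fun q hq => ?_
  rw [HasAntidiagonal.mem_antidiagonal] at hq
  rw [← hq, map_add] at hk
  rcases lt_or_ge q.1.degree m with h | h
  · rw [hf _ h, zero_mul]
  · rw [hg _ (by omega), mul_zero]

theorem X_mem_orderIdeal (i : σ) : (X i : MvPowerSeries σ ℂ) ∈ orderIdeal σ 1 := by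
  classical
  intro k hk
  rw [coeff_X, if_neg]
  rintro rfl
  simp at hk

theorem constantCoeff_eq_zero_of_mem {g : MvPowerSeries σ ℂ} (hg : g ∈ orderIdeal σ 1) :
    constantCoeff g = 0 := by
  have := hg 0 (by simp)
  simpa using this

theorem hasSubst_of_mem [Finite σ] {a : σ → MvPowerSeries σ ℂ} (ha : ∀ i, a i ∈ orderIdeal σ 1) :
    HasSubst a :=
  hasSubst_of_constantCoeff_zero fun i => constantCoeff_eq_zero_of_mem (ha i)

/-- Two formal power series agree if they agree to all orders. -/
theorem eq_of_forall_sub_mem {f g : MvPowerSeries σ ℂ} (h : ∀ m, f - g ∈ orderIdeal σ m) :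
    f = g := by
  ext k
  have := h (k.degree + 1) k (Nat.lt_succ_self _)
  rwa [map_sub, sub_eq_zero] at this

/-- The monomial `a ^ d` in the power series `a i`. -/
noncomputable def mono (a : σ → MvPowerSeries σ ℂ) (d : σ →₀ ℕ) : MvPowerSeries σ ℂ :=
  d.prod fun i e => a i ^ e

theorem mono_zero (a : σ → MvPowerSeries σ ℂ) : mono a 0 = 1 := Finsupp.prod_zero_index

theorem mono_add (a : σ → MvPowerSeries σ ℂ) (d e : σ →₀ ℕ) :
    mono a (d + e) = mono a d * mono a e := by
  classical
  exact Finsupp.prod_add_index' (by simp) (by simp [pow_add])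

theorem mono_single (a : σ → MvPowerSeries σ ℂ) (i : σ) : mono a (Finsupp.single i 1) = a i := by
  simp [mono]

theorem exists_eq_add_single {d : σ →₀ ℕ} {m : ℕ} (h : d.degree = m + 1) :
    ∃ e i, d = e + Finsupp.single i 1 ∧ e.degree = m := by
  have h0 : d ≠ 0 := by rintro rfl; simp at h
  obtain ⟨i, hi⟩ := Finsupp.ne_iff.1 h0
  have hle : Finsupp.single i 1 ≤ d := by
    rw [Finsupp.single_le_iff]
    exact Nat.one_le_iff_ne_zero.2 hi
  refine ⟨d - Finsupp.single i 1, i, (tsub_add_cancel_of_le hle).symm, ?_⟩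
  have := congrArg Finsupp.degree (tsub_add_cancel_of_le hle)
  rw [map_add, Finsupp.degree_single] at this
  omega

theorem mono_mem_orderIdeal {a : σ → MvPowerSeries σ ℂ} (ha : ∀ i, a i ∈ orderIdeal σ 1)
    {m : ℕ} {d : σ →₀ ℕ} (hd : d.degree = m) : mono a d ∈ orderIdeal σ m := by
  induction m generalizing d with
  | zero => exact mem_orderIdeal_zero _
  | succ m ih =>
    obtain ⟨e, i, rfl, he⟩ := exists_eq_add_single hd
    rw [mono_add, mono_single]
    exact mul_mem_orderIdeal (ih he) (ha i)

/-- Replace the factors one at a time: each replacement trades a factor of order `1` for one of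
order `p + 1`, a gain of exactly `p`. -/
theorem mono_sub_mem_orderIdeal {a b : σ → MvPowerSeries σ ℂ} (ha : ∀ i, a i ∈ orderIdeal σ 1)
    (hb : ∀ i, b i ∈ orderIdeal σ 1) {p : ℕ} (hab : ∀ i, a i - b i ∈ orderIdeal σ (p + 1))
    {m : ℕ} {d : σ →₀ ℕ} (hd : d.degree = m) : mono a d - mono b d ∈ orderIdeal σ (p + m) := by
  induction m generalizing d with
  | zero =>
    obtain rfl : d = 0 := (Finsupp.degree_eq_zero_iff _).1 hd
    simp [mono_zero]
  | succ m ih =>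
    obtain ⟨e, i, rfl, he⟩ := exists_eq_add_single hd
    rw [mono_add, mono_add, mono_single, mono_single,
      show mono a e * a i - mono b e * b i
        = (mono a e - mono b e) * a i + mono b e * (a i - b i) by ring]
    have h := mul_mem_orderIdeal (ih he) (ha i)
    rw [add_assoc] at h
    refine Ideal.add_mem _ h ?_
    have := mul_mem_orderIdeal (mono_mem_orderIdeal hb he) (hab i)
    rwa [show m + (p + 1) = p + (m + 1) by omega] at this

section Subst

variable [Finite σ]

theorem coeff_subst_eq_finsum {a : σ → MvPowerSeries σ ℂ} (ha : ∀ i, a i ∈ orderIdeal σ 1)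
    (g : MvPowerSeries σ ℂ) (k : σ →₀ ℕ) :
    coeff k (subst a g) = ∑ᶠ d, coeff d g * coeff k (mono a d) :=
  coeff_subst (hasSubst_of_mem ha) g k

theorem coeff_mono_support {a : σ → MvPowerSeries σ ℂ} (ha : ∀ i, a i ∈ orderIdeal σ 1)
    (g : MvPowerSeries σ ℂ) (k : σ →₀ ℕ) :
    (Function.support fun d => coeff d g * coeff k (mono a d)).Finite :=
  coeff_subst_finite (hasSubst_of_mem ha) g k

theorem subst_mem_orderIdeal {a : σ → MvPowerSeries σ ℂ} (ha : ∀ i, a i ∈ orderIdeal σ 1)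
    {m : ℕ} {g : MvPowerSeries σ ℂ} (hg : g ∈ orderIdeal σ m) :
    subst a g ∈ orderIdeal σ m := by
  intro k hk
  rw [coeff_subst_eq_finsum ha]
  refine finsum_eq_zero_of_forall_eq_zero fun d => ?_
  rcases lt_or_ge d.degree m with h | h
  · rw [hg d h, zero_mul]
  · rw [mono_mem_orderIdeal ha rfl k (hk.trans_le h), mul_zero]

/-- This is the formal contraction property: for `m = 2`, composition with `g` improves agreement of
the arguments by one order. -/
theorem subst_sub_subst_mem_orderIdeal {a b : σ → MvPowerSeries σ ℂ}
    (ha : ∀ i, a i ∈ orderIdeal σ 1) (hb : ∀ i, b i ∈ orderIdeal σ 1) {p : ℕ}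
    (hab : ∀ i, a i - b i ∈ orderIdeal σ (p + 1)) {m : ℕ} {g : MvPowerSeries σ ℂ}
    (hg : g ∈ orderIdeal σ m) : subst a g - subst b g ∈ orderIdeal σ (p + m) := by
  intro k hk
  rw [map_sub, coeff_subst_eq_finsum ha, coeff_subst_eq_finsum hb,
    ← finsum_sub_distrib (coeff_mono_support ha g k) (coeff_mono_support hb g k)]
  refine finsum_eq_zero_of_forall_eq_zero fun d => ?_
  rcases lt_or_ge d.degree m with h | h
  · rw [hg d h, zero_mul, zero_mul, sub_zero]
  · rw [← mul_sub, ← map_sub,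
      mono_sub_mem_orderIdeal ha hb hab rfl k (hk.trans_le (by omega)), mul_zero]

end Subst

/-! ### The weighted norm: products, change of radius, composition -/

/-- The weighted `ℓ¹` norm of the coefficients of a formal power series. -/
noncomputable def wnorm (ρ : ℝ≥0∞) (g : MvPowerSeries σ ℂ) : ℝ≥0∞ :=
  ∑' k : σ →₀ ℕ, ‖coeff k g‖ₑ * ρ ^ k.degree

variable {ρ ρ' : ℝ≥0∞}

theorem wnorm_le_of_coeff_le {f g : MvPowerSeries σ ℂ}
    (h : ∀ k, ‖coeff k f‖ₑ ≤ ‖coeff k g‖ₑ) : wnorm ρ f ≤ wnorm ρ g :=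
  ENNReal.tsum_le_tsum fun k => by gcongr; exact h k

theorem wnorm_zero : wnorm ρ (0 : MvPowerSeries σ ℂ) = 0 := by simp [wnorm]

theorem wnorm_neg (g : MvPowerSeries σ ℂ) : wnorm ρ (-g) = wnorm ρ g := by simp [wnorm]

theorem wnorm_add_le (f g : MvPowerSeries σ ℂ) : wnorm ρ (f + g) ≤ wnorm ρ f + wnorm ρ g := by
  rw [wnorm, wnorm, wnorm, ← ENNReal.tsum_add]
  refine ENNReal.tsum_le_tsum fun k => ?_
  rw [← add_mul, map_add]
  gcongr
  exact enorm_add_le _ _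

theorem wnorm_sub_le (f g : MvPowerSeries σ ℂ) : wnorm ρ (f - g) ≤ wnorm ρ f + wnorm ρ g := by
  rw [sub_eq_add_neg, ← wnorm_neg g]
  exact wnorm_add_le _ _

theorem wnorm_mul_le (f g : MvPowerSeries σ ℂ) : wnorm ρ (f * g) ≤ wnorm ρ f * wnorm ρ g := by
  classical
  calc wnorm ρ (f * g)
      ≤ ∑' k : σ →₀ ℕ, ∑ p ∈ HasAntidiagonal.antidiagonal k,
          (‖coeff p.1 f‖ₑ * ρ ^ p.1.degree) * (‖coeff p.2 g‖ₑ * ρ ^ p.2.degree) := by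
        refine ENNReal.tsum_le_tsum fun k => ?_
        rw [coeff_mul]
        refine (mul_le_mul_left (enorm_sum_le _ _) _).trans ?_
        rw [Finset.sum_mul]
        refine Finset.sum_le_sum fun p hp => ?_
        rw [HasAntidiagonal.mem_antidiagonal] at hp
        rw [enorm_mul, ← hp, map_add, pow_add]
        exact le_of_eq (by ring)
    _ = ∑' p : (σ →₀ ℕ) × (σ →₀ ℕ),
          (‖coeff p.1 f‖ₑ * ρ ^ p.1.degree) * (‖coeff p.2 g‖ₑ * ρ ^ p.2.degree) := by
        rw [← (HasAntidiagonal.sigmaAntidiagonalEquivProd (A := σ →₀ ℕ)).tsum_eq, ENNReal.tsum_sigma']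
        refine tsum_congr fun k => ?_
        rw [tsum_fintype]
        exact (Finset.sum_coe_sort (HasAntidiagonal.antidiagonal k) fun p =>
          (‖coeff p.1 f‖ₑ * ρ ^ p.1.degree) * (‖coeff p.2 g‖ₑ * ρ ^ p.2.degree)).symm
    _ = wnorm ρ f * wnorm ρ g := by
        rw [ENNReal.tsum_prod (f := fun p q : σ →₀ ℕ =>
          (‖coeff p f‖ₑ * ρ ^ p.degree) * (‖coeff q g‖ₑ * ρ ^ q.degree))]
        simp_rw [ENNReal.tsum_mul_left, ENNReal.tsum_mul_right]
        rfl

theorem wnorm_one : wnorm ρ (1 : MvPowerSeries σ ℂ) = 1 := by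
  classical
  rw [wnorm, tsum_eq_single 0]
  · simp
  · intro k hk
    simp [coeff_one, hk]

theorem wnorm_X (i : σ) : wnorm ρ (X i : MvPowerSeries σ ℂ) = ρ := by
  classical
  rw [wnorm, tsum_eq_single (Finsupp.single i 1)]
  · simp [coeff_X]
  · intro k hk
    simp [coeff_X, hk]

theorem wnorm_smul (c : ℂ) (g : MvPowerSeries σ ℂ) : wnorm ρ (c • g) = ‖c‖ₑ * wnorm ρ g := by
  rw [wnorm, wnorm, ← ENNReal.tsum_mul_left]
  refine tsum_congr fun k => ?_
  rw [coeff_smul, enorm_mul, mul_assoc]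

/-- Every monomial present has degree at least `m`. This gain under shrinking of the domain is what
pays for the small divisors. -/
theorem wnorm_mul_radius_le {t : ℝ≥0∞} (ht : t ≤ 1) {m : ℕ} {g : MvPowerSeries σ ℂ}
    (hg : g ∈ orderIdeal σ m) : wnorm (t * ρ) g ≤ t ^ m * wnorm ρ g := by
  rw [wnorm, wnorm, ← ENNReal.tsum_mul_left]
  refine ENNReal.tsum_le_tsum fun k => ?_
  rcases lt_or_ge k.degree m with h | h
  · simp [hg k h]
  · rw [mul_pow]
    calc ‖coeff k g‖ₑ * (t ^ k.degree * ρ ^ k.degree)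
        = t ^ k.degree * (‖coeff k g‖ₑ * ρ ^ k.degree) := by ring
      _ ≤ _ := by
        gcongr ?_ * _
        exact pow_le_pow_right_of_le_one' ht h

theorem wnorm_mono_le {a : σ → MvPowerSeries σ ℂ} (ha : ∀ i, wnorm ρ (a i) ≤ ρ')
    {m : ℕ} {d : σ →₀ ℕ} (hd : d.degree = m) : wnorm ρ (mono a d) ≤ ρ' ^ m := by
  induction m generalizing d with
  | zero =>
    obtain rfl : d = 0 := (Finsupp.degree_eq_zero_iff _).1 hd
    simp [mono_zero, wnorm_one]
  | succ m ih =>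
    obtain ⟨e, i, rfl, he⟩ := exists_eq_add_single hd
    rw [mono_add, mono_single, pow_succ]
    exact (wnorm_mul_le _ _).trans (mul_le_mul' (ih he) (ha i))

theorem wnorm_mono_sub_le {a b : σ → MvPowerSeries σ ℂ} {δ : ℝ≥0∞}
    (ha : ∀ i, wnorm ρ (a i) ≤ (1 + δ) * ρ') (hb : ∀ i, wnorm ρ (b i) ≤ ρ')
    (hab : ∀ i, wnorm ρ (a i - b i) ≤ δ * ρ') {m : ℕ} {d : σ →₀ ℕ} (hd : d.degree = m) :
    wnorm ρ (mono a d - mono b d) ≤ m * δ * (1 + δ) ^ m * ρ' ^ m := by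
  induction m generalizing d with
  | zero =>
    obtain rfl : d = 0 := (Finsupp.degree_eq_zero_iff _).1 hd
    simp [mono_zero, wnorm_zero]
  | succ m ih =>
    obtain ⟨e, i, rfl, he⟩ := exists_eq_add_single hd
    rw [mono_add, mono_add, mono_single, mono_single,
      show mono a e * a i - mono b e * b i
        = (mono a e - mono b e) * a i + mono b e * (a i - b i) by ring]
    calc wnorm ρ ((mono a e - mono b e) * a i + mono b e * (a i - b i))
        ≤ m * δ * (1 + δ) ^ m * ρ' ^ m * ((1 + δ) * ρ') + ρ' ^ m * (δ * ρ') :=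
          (wnorm_add_le _ _).trans (add_le_add
            ((wnorm_mul_le _ _).trans (mul_le_mul' (ih he) (ha i)))
            ((wnorm_mul_le _ _).trans (mul_le_mul' (wnorm_mono_le hb he) (hab i))))
      _ ≤ m * δ * (1 + δ) ^ m * ρ' ^ m * ((1 + δ) * ρ') +
            (1 + δ) ^ (m + 1) * (ρ' ^ m * (δ * ρ')) := by
          exact add_le_add_right (le_mul_of_one_le_left'
            (one_le_pow_of_one_le' (le_self_add : (1 : ℝ≥0∞) ≤ 1 + δ) _)) _
      _ = _ := by push_cast; ring

section Subst

variable [Finite σ]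

theorem enorm_coeff_subst_le {a : σ → MvPowerSeries σ ℂ} (ha : ∀ i, a i ∈ orderIdeal σ 1)
    (g : MvPowerSeries σ ℂ) (k : σ →₀ ℕ) :
    ‖coeff k (subst a g)‖ₑ ≤ ∑' d, ‖coeff d g‖ₑ * ‖coeff k (mono a d)‖ₑ := by
  rw [coeff_subst_eq_finsum ha, finsum_eq_sum _ (coeff_mono_support ha g k)]
  refine (enorm_sum_le _ _).trans ?_
  simp_rw [enorm_mul]
  exact ENNReal.sum_le_tsum _

/-- By submultiplicativity each monomial `a ^ d` costs at most `ρ' ^ |d|`, with a bound on each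
component separately; hence no factor depending on the number of variables. -/
theorem wnorm_subst_le {a : σ → MvPowerSeries σ ℂ} (ha : ∀ i, a i ∈ orderIdeal σ 1)
    (h : ∀ i, wnorm ρ (a i) ≤ ρ') (g : MvPowerSeries σ ℂ) :
    wnorm ρ (subst a g) ≤ wnorm ρ' g := by
  calc wnorm ρ (subst a g)
      ≤ ∑' k : σ →₀ ℕ, ∑' d, ‖coeff d g‖ₑ * (‖coeff k (mono a d)‖ₑ * ρ ^ k.degree) := by
        refine ENNReal.tsum_le_tsum fun k => ?_
        simp_rw [← mul_assoc]
        rw [ENNReal.tsum_mul_right]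
        gcongr
        exact enorm_coeff_subst_le ha g k
    _ = ∑' d, ‖coeff d g‖ₑ * wnorm ρ (mono a d) := by
        rw [ENNReal.tsum_comm]
        simp_rw [ENNReal.tsum_mul_left]
        rfl
    _ ≤ wnorm ρ' g := by
        refine ENNReal.tsum_le_tsum fun d => ?_
        gcongr
        exact wnorm_mono_le h rfl

/-- A mean value estimate for homogeneous `g`: differentiation costs the factor `m`, and `(1 + δ) ^
m` accounts for the enlarged argument. Unlike with a Cauchy estimate, the norm of `g` is needed only
at the radius `ρ'`. -/
theorem wnorm_subst_sub_subst_le {a b : σ → MvPowerSeries σ ℂ}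
    (ha : ∀ i, a i ∈ orderIdeal σ 1) (hb : ∀ i, b i ∈ orderIdeal σ 1) {δ : ℝ≥0∞}
    (ha' : ∀ i, wnorm ρ (a i) ≤ (1 + δ) * ρ') (hb' : ∀ i, wnorm ρ (b i) ≤ ρ')
    (hab : ∀ i, wnorm ρ (a i - b i) ≤ δ * ρ') {m : ℕ} {g : MvPowerSeries σ ℂ}
    (hg : ∀ d : σ →₀ ℕ, d.degree ≠ m → coeff d g = 0) :
    wnorm ρ (subst a g - subst b g) ≤ m * δ * (1 + δ) ^ m * wnorm ρ' g := by
  calc wnorm ρ (subst a g - subst b g)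
      ≤ ∑' k : σ →₀ ℕ, ∑' d,
          ‖coeff d g‖ₑ * (‖coeff k (mono a d - mono b d)‖ₑ * ρ ^ k.degree) := by
        refine ENNReal.tsum_le_tsum fun k => ?_
        simp_rw [← mul_assoc]
        rw [ENNReal.tsum_mul_right]
        gcongr
        have hf := (coeff_mono_support ha g k).union (coeff_mono_support hb g k)
        rw [map_sub, coeff_subst_eq_finsum ha, coeff_subst_eq_finsum hb,
          finsum_eq_sum_of_support_subset (s := hf.toFinset) _ (by simp),
          finsum_eq_sum_of_support_subset (s := hf.toFinset) _ (by simp),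
          ← Finset.sum_sub_distrib]
        simp_rw [← mul_sub, ← map_sub]
        refine (enorm_sum_le _ _).trans ?_
        simp_rw [enorm_mul]
        exact ENNReal.sum_le_tsum _
    _ = ∑' d, ‖coeff d g‖ₑ * wnorm ρ (mono a d - mono b d) := by
        rw [ENNReal.tsum_comm]
        simp_rw [ENNReal.tsum_mul_left]
        rfl
    _ ≤ m * δ * (1 + δ) ^ m * wnorm ρ' g := by
        rw [wnorm, ← ENNReal.tsum_mul_left]
        refine ENNReal.tsum_le_tsum fun d => ?_
        rcases eq_or_ne d.degree m with h | h
        · rw [h]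
          calc _ ≤ ‖coeff d g‖ₑ * (m * δ * (1 + δ) ^ m * ρ' ^ m) := by
                gcongr
                exact wnorm_mono_sub_le ha' hb' hab h
            _ = _ := by ring
        · simp [hg d h]

end Subst

end

/-! ### Formal limits and inverses of near-identity maps -/

section

variable {σ : Type*}

/-- A sequence of formal power series whose increments have increasing orders converges, and
bounds on the weighted norms pass to the limit. -/
theorem exists_formal_limit (a : ℕ → MvPowerSeries σ ℂ)
    (h : ∀ m, a (m + 1) - a m ∈ orderIdeal σ (m + 1)) :
    ∃ b : MvPowerSeries σ ℂ, (∀ m, b - a m ∈ orderIdeal σ (m + 1)) ∧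
      ∀ ρ M : ℝ≥0∞, (∀ m, wnorm ρ (a m) ≤ M) → wnorm ρ b ≤ M := by
  have key : ∀ m p, m ≤ p → a p - a m ∈ orderIdeal σ (m + 1) := by
    intro m p hmp
    induction p, hmp using Nat.le_induction with
    | base => simp
    | succ p hp ih =>
      have := Ideal.add_mem _ (orderIdeal_anti (Nat.succ_le_succ hp) (h p)) ih
      rwa [sub_add_sub_cancel] at this
  have hc : ∀ (k : σ →₀ ℕ) (m : ℕ), k.degree ≤ m → coeff k (a m) = coeff k (a k.degree) := by
    intro k m hkm
    have := key _ _ hkm k (Nat.lt_succ_self _)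
    rwa [map_sub, sub_eq_zero] at this
  obtain ⟨b, hb⟩ : ∃ b : MvPowerSeries σ ℂ, ∀ k, coeff k b = coeff k (a k.degree) :=
    ⟨fun k => coeff k (a k.degree), fun _ => rfl⟩
  refine ⟨b, fun m k hk => ?_, fun ρ M hM => ?_⟩
  · rw [map_sub, sub_eq_zero, hc k m (Nat.lt_succ_iff.1 hk), hb]
  -- Any finite set of coefficients of the limit already occurs in one `a m`, with `m` the largest
  -- degree involved, so every partial sum is at most `M`.
  · rw [wnorm, ENNReal.tsum_eq_iSup_sum]
    refine iSup_le fun s => (le_trans ?_ (hM (s.sup Finsupp.degree)))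
    refine le_trans (le_of_eq (Finset.sum_congr rfl fun k hk => ?_)) (ENNReal.sum_le_tsum s)
    rw [hc k _ (Finset.le_sup hk), hb]

/-- The near-identity formal map `x + U x`. -/
noncomputable def nearId (U : σ → MvPowerSeries σ ℂ) : σ → MvPowerSeries σ ℂ :=
  fun i => X i + U i

theorem nearId_mem {U : σ → MvPowerSeries σ ℂ} {m : ℕ} (hm : 1 ≤ m)
    (hU : ∀ i, U i ∈ orderIdeal σ m) (i : σ) : nearId U i ∈ orderIdeal σ 1 :=
  Ideal.add_mem _ (X_mem_orderIdeal i) (orderIdeal_anti hm (hU i))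

theorem wnorm_nearId_le {U : σ → MvPowerSeries σ ℂ} {ρ δ : ℝ≥0∞} {i : σ}
    (hU : wnorm ρ (U i) ≤ δ * ρ) : wnorm ρ (nearId U i) ≤ (1 + δ) * ρ := by
  refine (wnorm_add_le _ _).trans ?_
  rw [wnorm_X, add_mul, one_mul]
  gcongr

variable [Finite σ]

theorem subst_nearId_apply {a : σ → MvPowerSeries σ ℂ} (ha : ∀ i, a i ∈ orderIdeal σ 1)
    (U : σ → MvPowerSeries σ ℂ) (i : σ) : subst a (nearId U i) = a i + subst a (U i) := by
  rw [nearId, subst_add (hasSubst_of_mem ha), subst_X (hasSubst_of_mem ha)]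

/-- Right inverse of a near-identity formal map, with a bound. -/
theorem exists_right_inverse {U : σ → MvPowerSeries σ ℂ} (hU : ∀ i, U i ∈ orderIdeal σ 2) :
    ∃ Z : σ → MvPowerSeries σ ℂ, (∀ i, Z i ∈ orderIdeal σ 2) ∧
      (∀ i, subst (nearId Z) (nearId U i) = X i) ∧
      ∀ ρ δ : ℝ≥0∞, (∀ i, wnorm ((1 + δ) * ρ) (U i) ≤ δ * ρ) → ∀ i, wnorm ρ (Z i) ≤ δ * ρ := by
  -- The equation `(id + U) ∘ (id + Z) = id` is the fixed point equation `Z = -U ∘ (id + Z)`. Since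
  -- `U` has order two, iteration from `0` gains one order per step, and the ball of radius `δρ` is
  -- preserved.
  obtain ⟨Z, hZ0, hZs⟩ : ∃ Z : ℕ → σ → MvPowerSeries σ ℂ, (∀ i, Z 0 i = 0) ∧
      ∀ m i, Z (m + 1) i = -subst (nearId (Z m)) (U i) :=
    ⟨fun m => Nat.rec (fun _ => 0) (fun _ z i => -subst (nearId z) (U i)) m,
      fun _ => rfl, fun _ _ => rfl⟩
  have hZ2 : ∀ m i, Z m i ∈ orderIdeal σ 2 := by
    intro m
    induction m with
    | zero => exact fun i => (hZ0 i).symm ▸ Ideal.zero_mem _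
    | succ m ih =>
      intro i
      rw [hZs]
      exact neg_mem (subst_mem_orderIdeal (nearId_mem one_le_two ih) (hU i))
  have hd : ∀ m i, Z (m + 1) i - Z m i ∈ orderIdeal σ (m + 2) := by
    intro m
    induction m with
    | zero => exact fun i => sub_mem (hZ2 1 i) (hZ2 0 i)
    | succ m ih =>
      intro i
      rw [hZs (m + 1), hZs m, neg_sub_neg, ← neg_sub]
      refine neg_mem (subst_sub_subst_mem_orderIdeal (p := m + 1) (m := 2)
        (nearId_mem one_le_two (hZ2 _)) (nearId_mem one_le_two (hZ2 _)) (fun j => ?_) (hU i))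
      rw [nearId, nearId, add_sub_add_left_eq_sub]
      exact ih j
  choose W hW hWn using fun i => exists_formal_limit (fun m => Z m i)
    fun m => orderIdeal_anti (Nat.le_succ _) (hd m i)
  have hW2 : ∀ i, W i ∈ orderIdeal σ 2 := fun i => by
    have := add_mem (hW i 1) (hZ2 1 i)
    rwa [sub_add_cancel] at this
  refine ⟨W, hW2, fun i => ?_, fun ρ δ h i => hWn i _ _ fun m => ?_⟩
  · refine eq_of_forall_sub_mem fun m => ?_
    rw [subst_nearId_apply (nearId_mem one_le_two hW2), nearId]
    have h1 := subst_sub_subst_mem_orderIdeal (p := m) (m := 2) (nearId_mem one_le_two hW2)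
      (nearId_mem one_le_two (hZ2 m))
      (fun j => by rw [nearId, nearId, add_sub_add_left_eq_sub]; exact hW j m) (hU i)
    have h2 := add_mem (orderIdeal_anti (by omega : m ≤ m + 1 + 1) (hW i (m + 1)))
      (orderIdeal_anti (by omega : m ≤ m + 2) h1)
    rw [hZs] at h2
    convert h2 using 1
    ring
  · induction m generalizing i with
    | zero => exact (hZ0 i).symm ▸ (wnorm_zero (σ := σ)).le.trans zero_le
    | succ m ih =>
      rw [hZs, wnorm_neg]
      exact (wnorm_subst_le (nearId_mem one_le_two (hZ2 m))
        (fun j => wnorm_nearId_le (ih j)) _).trans (h i)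

/-- Left inverse of a near-identity formal map, with a bound. -/
theorem exists_left_inverse {U : σ → MvPowerSeries σ ℂ} (hU : ∀ i, U i ∈ orderIdeal σ 2) :
    ∃ Z : σ → MvPowerSeries σ ℂ, (∀ i, Z i ∈ orderIdeal σ 2) ∧
      (∀ i, subst (nearId U) (nearId Z i) = X i) ∧
      ∀ ρ δ : ℝ≥0∞, (∀ i, wnorm ((1 + δ) * ρ) (U i) ≤ δ * ρ) → ∀ i, wnorm ρ (Z i) ≤ δ * ρ := by
  obtain ⟨Z, hZ, hUZ, hZn⟩ := exists_right_inverse hU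
  obtain ⟨W, hW, hZW, -⟩ := exists_right_inverse hZ
  have hsZ := hasSubst_of_mem (nearId_mem one_le_two hZ)
  have hsW := hasSubst_of_mem (nearId_mem one_le_two hW)
  refine ⟨Z, hZ, fun i => ?_, hZn⟩
  -- `id + Z` has left inverse `id + U` and right inverse `id + W`, so the two coincide by
  -- associativity.
  have : nearId U = nearId W := by
    funext i
    calc nearId U i = subst X (nearId U i) := by rw [subst_self, id]
      _ = subst (fun j => subst (nearId W) (nearId Z j)) (nearId U i) := by
        congr 1; funext j; exact (hZW j).symm
      _ = subst (nearId W) (subst (nearId Z) (nearId U i)) :=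
        (subst_comp_subst_apply hsZ hsW _).symm
      _ = nearId W i := by rw [hUZ, subst_X hsW]
  rw [this, hZW]

end

/-! ### The homological equation and one normalization step -/

section Step

variable {n : ℕ}

/-- The formal map `Λ (x + v x)`. -/
noncomputable def linMul (lam : Fin n → ℂ) (v : Fin n → MvPowerSeries (Fin n) ℂ) :
    Fin n → MvPowerSeries (Fin n) ℂ :=
  fun j => lam j • nearId v j

theorem linMul_mem (lam : Fin n → ℂ) {v : Fin n → MvPowerSeries (Fin n) ℂ} {m : ℕ} (hm : 1 ≤ m)
    (hv : ∀ i, v i ∈ orderIdeal _ m) (j : Fin n) : linMul lam v j ∈ orderIdeal _ 1 :=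
  Submodule.smul_of_tower_mem _ _ (nearId_mem hm hv j)

/-- The solution of the homological equation in degree `m`. -/
noncomputable def homSol (lam : Fin n → ℂ) (m : ℕ) (v : Fin n → MvPowerSeries (Fin n) ℂ) :
    Fin n → MvPowerSeries (Fin n) ℂ :=
  fun j k => if k.degree = m then
    coeff k (v j) / (1 - (∏ i, lam i ^ k i) * (lam j)⁻¹) else 0

/-- The part of degree `m`. -/
noncomputable def homPart (m : ℕ) (g : MvPowerSeries (Fin n) ℂ) : MvPowerSeries (Fin n) ℂ :=
  fun k => if k.degree = m then coeff k g else 0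

theorem coeff_homSol (lam : Fin n → ℂ) (m : ℕ) (v : Fin n → MvPowerSeries (Fin n) ℂ)
    (j : Fin n) (k : Fin n →₀ ℕ) : coeff k (homSol lam m v j) = if k.degree = m then
    coeff k (v j) / (1 - (∏ i, lam i ^ k i) * (lam j)⁻¹) else 0 := rfl

theorem coeff_homPart (m : ℕ) (g : MvPowerSeries (Fin n) ℂ) (k : Fin n →₀ ℕ) :
    coeff k (homPart m g) = if k.degree = m then coeff k g else 0 := rfl

theorem mono_smul_X (lam : Fin n → ℂ) (d : Fin n →₀ ℕ) :
    mono (fun i => lam i • (X i : MvPowerSeries (Fin n) ℂ)) d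
      = (∏ i, lam i ^ d i) • (monomial d (1 : ℂ)) := by
  rw [mono, Finsupp.prod_fintype _ _ (fun i => pow_zero _)]
  simp_rw [smul_pow]
  rw [Finset.prod_smul, monomial_one_eq, Finsupp.prod_fintype _ _ (fun i => pow_zero _)]

theorem coeff_subst_smul_X (lam : Fin n → ℂ) (g : MvPowerSeries (Fin n) ℂ) (k : Fin n →₀ ℕ) :
    coeff k (subst (fun i => lam i • (X i : MvPowerSeries (Fin n) ℂ)) g)
      = (∏ i, lam i ^ k i) * coeff k g := by
  rw [coeff_subst_eq_finsum (fun i => Submodule.smul_of_tower_mem _ _ (X_mem_orderIdeal i)),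
    finsum_eq_single _ k]
  · rw [mono_smul_X, coeff_smul, coeff_monomial_same, mul_one, mul_comm]
  · intro d hd
    rw [mono_smul_X, coeff_smul, coeff_monomial_ne hd.symm, mul_zero, mul_zero]

/-- The homological equation `Λ⁻¹ U (Λ x) = U x - v_m x`. -/
theorem subst_smul_X_homSol {lam : Fin n → ℂ} (hlam : ∀ j, lam j ≠ 0) {m : ℕ}
    (hres : ∀ (k : Fin n →₀ ℕ) (j : Fin n), k.degree = m → (∏ i, lam i ^ k i) * (lam j)⁻¹ ≠ 1)
    (v : Fin n → MvPowerSeries (Fin n) ℂ) (j : Fin n) :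
    subst (fun i => lam i • (X i : MvPowerSeries (Fin n) ℂ)) (homSol lam m v j)
      = lam j • (homSol lam m v j - homPart m (v j)) := by
  ext k
  rw [coeff_subst_smul_X, coeff_smul, map_sub, coeff_homSol, coeff_homPart]
  split_ifs with h
  · have h1 : 1 - (∏ i, lam i ^ k i) * (lam j)⁻¹ ≠ 0 := sub_ne_zero.2 (hres k j h).symm
    have h2 := hlam j
    generalize (∏ i, lam i ^ k i) = c at *
    rw [mul_div_assoc', div_eq_iff h1, mul_assoc, sub_mul, div_mul_cancel₀ _ h1]
    field_simp
    ring
  · simp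

/-- The homological equation is an identity of series, so it may be used at the point `x + v x`. The
composition `U ∘ F` is thereby expressed without evaluating a norm at `Λx`, and the moduli of the
eigenvalues drop out of the estimates. -/
theorem subst_linMul_homSol {lam : Fin n → ℂ} (hlam : ∀ j, lam j ≠ 0) {m : ℕ}
    (hres : ∀ (k : Fin n →₀ ℕ) (j : Fin n), k.degree = m → (∏ i, lam i ^ k i) * (lam j)⁻¹ ≠ 1)
    {v : Fin n → MvPowerSeries (Fin n) ℂ} (hv : ∀ i, nearId v i ∈ orderIdeal _ 1) (j : Fin n) :
    subst (linMul lam v) (homSol lam m v j)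
      = lam j • subst (nearId v) (homSol lam m v j - homPart m (v j)) := by
  have h1 : HasSubst (fun i => lam i • (X i : MvPowerSeries (Fin n) ℂ)) :=
    hasSubst_of_mem fun i => Submodule.smul_of_tower_mem _ _ (X_mem_orderIdeal i)
  have h2 := hasSubst_of_mem hv
  rw [← subst_smul h2, ← subst_smul_X_homSol hlam hres, subst_comp_subst_apply h1 h2]
  congr 1
  funext i
  rw [subst_smul h2, subst_X h2, linMul]

/-- One normalization step: removal of the terms of degree `r + 1`. -/
theorem exists_step {lam : Fin n → ℂ} (hlam : ∀ j, lam j ≠ 0) {r : ℕ} (hr : 1 ≤ r)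
    {α η ρ : ℝ≥0∞} (hα0 : α ≠ 0) (hα1 : α ≤ 1)
    (hα : ∀ (k : Fin n →₀ ℕ) (j : Fin n), k.degree = r + 1 →
      α ≤ ‖(∏ i, lam i ^ k i) * (lam j)⁻¹ - 1‖ₑ)
    (hη : 2 * η ≤ 1) (hη' : (1 + η) ^ (r + 1) ≤ 2)
    {v : Fin n → MvPowerSeries (Fin n) ℂ} (hv : ∀ j, v j ∈ orderIdeal _ (r + 1))
    (hvn : ∀ j, wnorm ((1 + 2 * η) * ρ) (v j) ≤ η * α * ((1 + 2 * η) * ρ)) :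
    ∃ U v' : Fin n → MvPowerSeries (Fin n) ℂ,
      (∀ j, U j ∈ orderIdeal _ (r + 1)) ∧ (∀ j, v' j ∈ orderIdeal _ (r + 2)) ∧
      (∀ j, subst (linMul lam v) (nearId U j) = subst (nearId U) (linMul lam v' j)) ∧
      (∀ j, wnorm ((1 + 2 * η) * ρ) (U j) ≤ η * ((1 + 2 * η) * ρ)) ∧
      (∀ j, wnorm ρ (v' j) ≤
        η * (1 + 2 * η) * (1 + 4 * (r + 1 : ℕ) * η) * α * ρ) := by
  set ρ' := (1 + 2 * η) * ρ with hρ'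
  have hαt : α ≠ ⊤ := (hα1.trans_lt ENNReal.one_lt_top).ne
  have hres : ∀ (k : Fin n →₀ ℕ) (j : Fin n), k.degree = r + 1 →
      (∏ i, lam i ^ k i) * (lam j)⁻¹ ≠ 1 := by
    intro k j hk h
    have := hα k j hk
    rw [h, sub_self, enorm_zero] at this
    exact hα0 (le_antisymm this zero_le)
  have hv1 := nearId_mem (Nat.le_add_left 1 r) hv
  set U := homSol lam (r + 1) v with hUdef
  have hU : ∀ j, U j ∈ orderIdeal _ (r + 1) := fun j k hk => by
    rw [hUdef, coeff_homSol, if_neg hk.ne]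
  have hU2 : ∀ j, U j ∈ orderIdeal _ 2 := fun j => orderIdeal_anti (by omega) (hU j)
  have hUn : ∀ j, wnorm ρ' (U j) ≤ η * ρ' := by
    intro j
    have h1 : wnorm ρ' (U j) * α ≤ wnorm ρ' (v j) := by
      rw [wnorm, wnorm, ← ENNReal.tsum_mul_right]
      refine ENNReal.tsum_le_tsum fun k => ?_
      rw [mul_right_comm]
      gcongr
      rw [hUdef, coeff_homSol]
      split_ifs with h
      · have h0 : 1 - (∏ i, lam i ^ k i) * (lam j)⁻¹ ≠ 0 := sub_ne_zero.2 (hres k j h).symm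
        calc _ ≤ ‖coeff k (v j) / (1 - (∏ i, lam i ^ k i) * (lam j)⁻¹)‖ₑ
              * ‖1 - (∏ i, lam i ^ k i) * (lam j)⁻¹‖ₑ := by
              gcongr
              rw [← enorm_neg, neg_sub]
              exact hα k j h
          _ = _ := by rw [← enorm_mul, div_mul_cancel₀ _ h0]
      · simp
    have h2 := h1.trans (hvn j)
    rw [mul_right_comm] at h2
    exact (ENNReal.mul_le_mul_iff_left hα0 hαt).1 h2
  -- `T` is `Λ⁻¹ U(Λx)`, but it is estimated through the right-hand side of the homological
  -- equation.
  set T : Fin n → MvPowerSeries (Fin n) ℂ := fun j => U j - homPart (r + 1) (v j) with hTdef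
  have hpart : ∀ j k, (coeff k (homPart (r + 1) (v j)) = coeff k (v j) ∧
      coeff k (v j - homPart (r + 1) (v j)) = 0) ∨
      (coeff k (homPart (r + 1) (v j)) = 0 ∧
      coeff k (v j - homPart (r + 1) (v j)) = coeff k (v j)) := by
    intro j k
    rw [map_sub, coeff_homPart]
    split_ifs with h <;> simp
  have hTn : ∀ j, wnorm ρ' (T j) ≤ 2 * η * ρ' := by
    intro j
    refine (wnorm_sub_le _ _).trans ?_
    have h1 : wnorm ρ' (homPart (r + 1) (v j)) ≤ wnorm ρ' (v j) :=
      wnorm_le_of_coeff_le fun k => by rcases hpart j k with h | h <;> rw [h.1]; simp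
    have h2 : wnorm ρ' (v j) ≤ η * ρ' := (hvn j).trans (by
      gcongr
      exact mul_le_of_le_one_right' hα1)
    calc _ ≤ η * ρ' + η * ρ' := add_le_add (hUn j) (h1.trans h2)
      _ = _ := by ring
  have hThom : ∀ j (d : Fin n →₀ ℕ), d.degree ≠ r + 1 → coeff d (T j) = 0 := by
    intro j d hd
    rw [hTdef, map_sub, hUdef, coeff_homSol, coeff_homPart, if_neg hd, if_neg hd, sub_zero]
  have hT : ∀ j, T j ∈ orderIdeal _ (r + 1) := fun j d hd => hThom j d hd.ne
  -- With `m = r + 1`, `(id + U) ∘ F = Λ(id + v + T ∘ (id + v))`, and substituting `v_m = U - T`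
  -- turns this into `Λ(id + U + w)`. Hence the new nonlinearity is `w ∘ (id + U)⁻¹`.
  set w : Fin n → MvPowerSeries (Fin n) ℂ :=
    fun j => v j - homPart (r + 1) (v j) + (subst (nearId v) (T j) - T j) with hwdef
  have hsX : ∀ g : MvPowerSeries (Fin n) ℂ, subst X g = g := fun g => by rw [subst_self, id]
  have hw : ∀ j, w j ∈ orderIdeal _ (r + 2) := by
    intro j
    refine add_mem (fun k hk => ?_) ?_
    · rcases lt_or_eq_of_le (Nat.lt_succ_iff.1 hk) with h | h
      · rcases hpart j k with h' | h'
        · exact h'.2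
        · rw [h'.2, hv j k h]
      · rw [map_sub, coeff_homPart, if_pos h, sub_self]
    · have := subst_sub_subst_mem_orderIdeal (p := r) hv1 X_mem_orderIdeal
        (fun i => by rw [nearId, add_sub_cancel_left]; exact hv i) (hT j)
      rw [hsX] at this
      exact orderIdeal_anti (by omega) this
  -- `T` alone has relative size `2η`, without the factor `α`. The difference `T ∘ (id + v) - T`
  -- regains it, since the displacement `v` has size `ηα`.
  have hwn : ∀ j, wnorm ρ' (w j) ≤ η * (1 + 4 * (r + 1 : ℕ) * η) * α * ρ' := by
    intro j
    have h1 : wnorm ρ' (v j - homPart (r + 1) (v j)) ≤ η * α * ρ' :=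
      (wnorm_le_of_coeff_le fun k => by
        rcases hpart j k with h | h <;> rw [h.2]; simp).trans (hvn j)
    have h2 := wnorm_subst_sub_subst_le (ρ := ρ') (ρ' := ρ') (δ := η * α) hv1 X_mem_orderIdeal
      (fun i => wnorm_nearId_le (hvn i)) (fun i => (wnorm_X i).le)
      (fun i => by rw [nearId, add_sub_cancel_left]; exact hvn i) (hThom j)
    rw [hsX] at h2
    have h3 : (1 + η * α) ^ (r + 1) ≤ 2 := by
      refine le_trans ?_ hη'
      gcongr
      exact mul_le_of_le_one_right' hα1
    calc wnorm ρ' (w j) ≤ η * α * ρ' + (r + 1 : ℕ) * (η * α) * 2 * (2 * η * ρ') := by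
          refine (wnorm_add_le _ _).trans (add_le_add h1 (h2.trans ?_))
          gcongr
          exact hTn j
      _ = _ := by ring
  obtain ⟨Z, hZ, hZU, hZn⟩ := exists_left_inverse hU2
  have hZ1 := nearId_mem one_le_two hZ
  have hU1 := nearId_mem one_le_two hU2
  -- With `δ = 2η`, the map `id + Z` sends radius `ρ` into radius `(1 + 2η)ρ`, where `w` is
  -- controlled. This is the only domain loss within the step.
  have hZn' := hZn ρ (2 * η) fun i => (hUn i).trans (by
    calc η * ((1 + 2 * η) * ρ) ≤ η * ((1 + 1) * ρ) := by gcongr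
      _ = 2 * η * ρ := by ring)
  refine ⟨U, fun j => subst (nearId Z) (w j), hU, fun j => subst_mem_orderIdeal hZ1 (hw j),
    fun j => ?_, hUn, fun j => ?_⟩
  · have hcomp : subst (nearId U) (subst (nearId Z) (w j)) = w j := by
      rw [subst_comp_subst_apply (hasSubst_of_mem hZ1) (hasSubst_of_mem hU1)]
      rw [show (fun s => subst (nearId U) (nearId Z s)) = X from funext hZU, hsX]
    rw [subst_nearId_apply (linMul_mem lam (Nat.le_add_left 1 r) hv), hUdef,
      subst_linMul_homSol hlam hres hv1, ← hUdef]
    rw [linMul, linMul, subst_smul (hasSubst_of_mem hU1), subst_nearId_apply hU1, hcomp,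
      ← smul_add]
    congr 1
    rw [nearId, nearId, hwdef]
    simp only [hTdef]
    ring
  · refine (wnorm_subst_le hZ1 (fun i => wnorm_nearId_le (hZn' i)) (w j)).trans
      ((hwn j).trans (le_of_eq ?_))
    rw [hρ']
    ring

end Step

/-! ### The radii of the domains and their total loss -/

section Radii

/-- The exponent `∑_{s ≤ r} L_s / (s (s + 1)) + L_r / (r + 1)`, `L_s = -log a_s`, which controls
the loss of domain after `r` steps. -/
noncomputable def lossExp (a : ℕ → ℝ) (r : ℕ) : ℝ :=
  ∑ s ∈ range r, -Real.log (a (s + 1)) / (((s : ℝ) + 1) * ((s : ℝ) + 2))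
    + -Real.log (a r) / ((r : ℝ) + 1)

/-- Summation by parts, since `1/(s(s+1)) = 1/s - 1/(s+1)`: the weights of Condition τ arise from
charging only for the decrease of `log a`. -/
theorem lossExp_succ_sub (a : ℕ → ℝ) (r : ℕ) :
    lossExp a (r + 1) - lossExp a r = (Real.log (a r) - Real.log (a (r + 1))) / ((r : ℝ) + 1) := by
  have h1 : (r : ℝ) + 1 ≠ 0 := by positivity
  have h2 : (r : ℝ) + 2 ≠ 0 := by positivity
  rw [lossExp, lossExp, Finset.sum_range_succ]
  push_cast
  rw [show (r : ℝ) + 1 + 1 = r + 2 by ring]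
  field_simp
  ring

theorem lossExp_le {a : ℕ → ℝ} (hpos : ∀ r, 0 < a r) (hle : ∀ r, a r ≤ 1) (hanti : Antitone a)
    {Γ : ℝ}
    (hΓ : HasSum (fun r : ℕ => -Real.log (a (r + 1)) / (((r : ℝ) + 1) * ((r : ℝ) + 2))) Γ)
    (r : ℕ) : lossExp a r ≤ Γ := by
  set u : ℕ → ℝ := fun r : ℕ => -Real.log (a (r + 1)) / (((r : ℝ) + 1) * ((r : ℝ) + 2)) with hu
  have hu0 : ∀ s, 0 ≤ u s := fun s =>
    div_nonneg (neg_nonneg.2 (Real.log_nonpos (hpos _).le (hle _))) (by positivity)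
  -- The boundary term is spread over the tail: `1/(r+1)` is the sum of `1/((s+1)(s+2))` over `s ≥
  -- r`, and `-log a` is increasing. Letting `M → ∞` removes what remains.
  have key : ∀ M, r ≤ M → lossExp a r ≤ ∑ s ∈ range M, u s + -Real.log (a r) / ((M : ℝ) + 1) := by
    intro M hM
    induction M, hM using Nat.le_induction with
    | base => exact le_rfl
    | succ M hM ih =>
      refine ih.trans ?_
      rw [Finset.sum_range_succ, add_assoc]
      gcongr
      have hlog : Real.log (a (M + 1)) ≤ Real.log (a r) :=
        Real.log_le_log (hpos _) (hanti (by omega))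
      have h1 : -Real.log (a r) / (((M : ℝ) + 1) * ((M : ℝ) + 2)) ≤ u M := by
        change _ ≤ -Real.log (a (M + 1)) / (((M : ℝ) + 1) * ((M : ℝ) + 2))
        gcongr
      have h2 : -Real.log (a r) / ((M : ℝ) + 1)
          = -Real.log (a r) / (((M : ℝ) + 1) * ((M : ℝ) + 2)) +
            -Real.log (a r) / (((M + 1 : ℕ) : ℝ) + 1) := by
        have h1 : (M : ℝ) + 1 ≠ 0 := by positivity
        have h2 : (M : ℝ) + 2 ≠ 0 := by positivity
        push_cast
        rw [show (M : ℝ) + 1 + 1 = M + 2 by ring]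
        field_simp
        ring
      rw [h2]
      gcongr
  have hlim : Tendsto (fun M : ℕ => Γ + -Real.log (a r) / ((M : ℝ) + 1)) atTop (𝓝 (Γ + 0)) := by
    refine tendsto_const_nhds.add ?_
    have := (tendsto_one_div_add_atTop_nhds_zero_nat (𝕜 := ℝ)).const_mul (-Real.log (a r))
    simpa [div_eq_mul_inv] using this
  rw [add_zero] at hlim
  refine ge_of_tendsto hlim (Filter.eventually_atTop.2 ⟨r, fun M hM => (key M hM).trans ?_⟩)
  gcongr
  exact sum_le_hasSum _ (fun s _ => hu0 s) hΓ

/-- The relative size of the nonlinearity after the restriction of the domain in step `s + 1`. -/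
noncomputable def stepSize (s : ℕ) : ℝ := ((s : ℝ) + 1) / (16 * ((s : ℝ) + 2) ^ 3)

theorem stepSize_nonneg (s : ℕ) : 0 ≤ stepSize s := by rw [stepSize]; positivity

theorem stepSize_le (s : ℕ) : stepSize s ≤ 1 / (16 * ((s : ℝ) + 2) ^ 2) := by
  rw [stepSize, div_le_div_iff₀ (by positivity) (by positivity)]
  have : (0 : ℝ) ≤ s := s.cast_nonneg
  nlinarith [sq_nonneg ((s : ℝ) + 2)]

/-- The logarithm of the ratio of restriction of the domain in step `s + 1`. -/
noncomputable def logRatio (a : ℕ → ℝ) (s : ℕ) : ℝ :=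
  (Real.log (a (s + 1)) - Real.log (a s) + 3 * (Real.log ((s : ℝ) + 1) - Real.log ((s : ℝ) + 2)))
    / ((s : ℝ) + 1)

/-- The ratio is chosen so that its power `s + 1` replaces `a s` by the next divisor bound. Of the
three factors `(s+1)/(s+2)`, two update the weight `1/(s+1)²` to `1/(s+2)²`; the third absorbs the
error factors of the step. -/
theorem exp_logRatio_pow {a : ℕ → ℝ} (hpos : ∀ r, 0 < a r) (s : ℕ) :
    Real.exp (logRatio a s) ^ (s + 1) * a s
      = a (s + 1) * (((s : ℝ) + 1) / ((s : ℝ) + 2)) ^ 3 := by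
  have h1 : (0 : ℝ) < s + 1 := by positivity
  have h2 : (0 : ℝ) < s + 2 := by positivity
  rw [← Real.exp_nat_mul, logRatio]
  push_cast
  rw [mul_div_cancel₀ _ h1.ne', Real.exp_add, Real.exp_sub, Real.exp_log (hpos _),
    Real.exp_log (hpos _), ← Real.log_div h1.ne' h2.ne', mul_comm (3 : ℝ), Real.exp_mul,
    Real.exp_log (by positivity)]
  have := (hpos s).ne'
  norm_cast
  field_simp

theorem logRatio_nonpos {a : ℕ → ℝ} (hpos : ∀ r, 0 < a r) (hanti : Antitone a) (s : ℕ) :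
    logRatio a s ≤ 0 := by
  have h1 : Real.log (a (s + 1)) ≤ Real.log (a s) :=
    Real.log_le_log (hpos _) (hanti (Nat.le_succ s))
  have h2 : Real.log ((s : ℝ) + 1) ≤ Real.log ((s : ℝ) + 2) :=
    Real.log_le_log (by positivity) (by linarith)
  exact div_nonpos_of_nonpos_of_nonneg (by linarith) (by positivity)

/-- The radii of the domains. -/
noncomputable def radius (a : ℕ → ℝ) (ρ₀ : ℝ) : ℕ → ℝ
  | 0 => ρ₀
  | s + 1 => Real.exp (logRatio a s) * radius a ρ₀ s / (1 + 2 * stepSize s)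

theorem radius_succ (a : ℕ → ℝ) (ρ₀ : ℝ) (s : ℕ) :
    (1 + 2 * stepSize s) * radius a ρ₀ (s + 1) = Real.exp (logRatio a s) * radius a ρ₀ s := by
  have := stepSize_nonneg s
  rw [radius, mul_div_cancel₀]
  positivity

theorem radius_pos (a : ℕ → ℝ) {ρ₀ : ℝ} (h : 0 < ρ₀) (s : ℕ) : 0 < radius a ρ₀ s := by
  induction s with
  | zero => exact h
  | succ s ih =>
    have := stepSize_nonneg s
    rw [radius]
    positivity

theorem le_radius {a : ℕ → ℝ} (h0 : a 0 = 1) {ρ₀ : ℝ} (hρ : 0 < ρ₀) (r : ℕ) :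
    ρ₀ * Real.exp (-8) * Real.exp (-lossExp a r) ≤ radius a ρ₀ r := by
  -- The losses not due to divisors are at most `4/(s+1)²` per step, and this is below the
  -- telescoping difference `8/(s+1) - 8/(s+2)`; their total is at most `8`.
  suffices h : ρ₀ * Real.exp (-lossExp a r - 8 * (1 - 1 / ((r : ℝ) + 1))) ≤ radius a ρ₀ r by
    refine le_trans ?_ h
    rw [mul_assoc, ← Real.exp_add]
    gcongr
    have : 0 ≤ 1 / ((r : ℝ) + 1) := by positivity
    linarith
  induction r with
  | zero => simp [lossExp, h0, radius]
  | succ s ih =>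
    have hs := stepSize_nonneg s
    have hs1 : (0 : ℝ) < s + 1 := by positivity
    have hs2 : (0 : ℝ) < s + 2 := by positivity
    have h1 : 1 + 2 * stepSize s ≤ Real.exp (2 * stepSize s) := by
      rw [add_comm]
      exact Real.add_one_le_exp _
    have h2 : Real.log ((s : ℝ) + 2) - Real.log ((s : ℝ) + 1) ≤ 1 / ((s : ℝ) + 1) := by
      rw [← Real.log_div hs2.ne' hs1.ne']
      refine (Real.log_le_sub_one_of_pos (by positivity)).trans (le_of_eq ?_)
      field_simp
      ring
    have h3 : logRatio a s ≥ -(lossExp a (s + 1) - lossExp a s) - 3 / ((s : ℝ) + 1) ^ 2 := by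
      rw [lossExp_succ_sub, logRatio, ge_iff_le, sub_le_iff_le_add, pow_two, ← div_div,
        ← add_div, ← neg_div]
      gcongr
      have : 3 / ((s : ℝ) + 1) = 3 * (1 / ((s : ℝ) + 1)) := by ring
      rw [this]
      linarith
    have h4 : 3 / ((s : ℝ) + 1) ^ 2 + 2 * stepSize s
        ≤ 8 * (1 / ((s : ℝ) + 1)) - 8 * (1 / ((s : ℝ) + 2)) := by
      have e1 : 1 / (16 * ((s : ℝ) + 2) ^ 2) ≤ 1 / (2 * ((s : ℝ) + 1) ^ 2) := by
        apply one_div_le_one_div_of_le (by positivity)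
        nlinarith
      have e2 : 3 / ((s : ℝ) + 1) ^ 2 + 2 * (1 / (2 * ((s : ℝ) + 1) ^ 2))
          = 4 / ((s : ℝ) + 1) ^ 2 := by
        field_simp
        ring
      have e3 : 8 * (1 / ((s : ℝ) + 1)) - 8 * (1 / ((s : ℝ) + 2))
          = 8 / (((s : ℝ) + 1) * ((s : ℝ) + 2)) := by
        field_simp
        ring
      have e4 : 4 / ((s : ℝ) + 1) ^ 2 ≤ 8 / (((s : ℝ) + 1) * ((s : ℝ) + 2)) := by
        rw [div_le_div_iff₀ (by positivity) (by positivity)]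
        nlinarith
      linarith [stepSize_le s]
    rw [radius, le_div_iff₀ (by positivity)]
    calc ρ₀ * Real.exp (-lossExp a (s + 1) - 8 * (1 - 1 / (((s + 1 : ℕ) : ℝ) + 1)))
          * (1 + 2 * stepSize s)
        ≤ ρ₀ * Real.exp (-lossExp a (s + 1) - 8 * (1 - 1 / (((s + 1 : ℕ) : ℝ) + 1)))
          * Real.exp (2 * stepSize s) := by gcongr
      _ ≤ Real.exp (logRatio a s)
          * (ρ₀ * Real.exp (-lossExp a s - 8 * (1 - 1 / ((s : ℝ) + 1)))) := by
        rw [mul_left_comm, ← Real.exp_add, mul_assoc, ← Real.exp_add]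
        refine mul_le_mul_of_nonneg_left (Real.exp_le_exp.2 ?_) hρ.le
        push_cast
        rw [show (s : ℝ) + 1 + 1 = s + 2 by ring]
        linarith
      _ ≤ _ := by gcongr

end Radii

/-! ### Iteration of the steps and convergence -/

section Iteration

variable {n : ℕ}

theorem one_add_stepSize_pow_le (s : ℕ) : (1 + stepSize s) ^ (s + 2) ≤ 2 := by
  have h0 := stepSize_nonneg s
  have h1 : ((s + 2 : ℕ) : ℝ) * stepSize s ≤ 1 / 2 := by
    have := stepSize_le s
    calc ((s + 2 : ℕ) : ℝ) * stepSize s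
        ≤ ((s + 2 : ℕ) : ℝ) * (1 / (16 * ((s : ℝ) + 2) ^ 2)) := by gcongr
      _ = 1 / (16 * ((s : ℝ) + 2)) := by
        push_cast
        field_simp
      _ ≤ 1 / 2 := by
        apply one_div_le_one_div_of_le (by norm_num)
        have : (0 : ℝ) ≤ s := s.cast_nonneg
        linarith
  calc (1 + stepSize s) ^ (s + 2) ≤ Real.exp (stepSize s) ^ (s + 2) := by
        gcongr
        rw [add_comm]
        exact Real.add_one_le_exp _
    _ = Real.exp (((s + 2 : ℕ) : ℝ) * stepSize s) := (Real.exp_nat_mul _ _).symm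
    _ ≤ Real.exp (1 / 2) := Real.exp_le_exp.2 h1
    _ ≤ 1 / (1 - 1 / 2) := Real.exp_bound_div_one_sub_of_interval (by norm_num) (by norm_num)
    _ = 2 := by norm_num

/-- The spare factor `(s+1)/(s+2) = 1 - 1/(s+2)` in `stepSize` outweighs both error factors, each at
most `1 + 1/(4(s+2))`. -/
theorem stepSize_mul_le (s : ℕ) :
    stepSize s * (1 + 2 * stepSize s) * (1 + 4 * ((s + 2 : ℕ) : ℝ) * stepSize s)
      ≤ 1 / (16 * ((s : ℝ) + 2) ^ 2) := by
  have h0 := stepSize_nonneg s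
  have hs : (0 : ℝ) ≤ s := s.cast_nonneg
  have h1 := stepSize_le s
  have h2 : 2 * stepSize s ≤ 1 / (4 * ((s : ℝ) + 2)) := by
    refine (mul_le_mul_of_nonneg_left h1 zero_le_two).trans ?_
    rw [mul_one_div, div_le_div_iff₀ (by positivity) (by positivity)]
    nlinarith
  have h3 : 4 * ((s + 2 : ℕ) : ℝ) * stepSize s ≤ 1 / (4 * ((s : ℝ) + 2)) := by
    refine (mul_le_mul_of_nonneg_left h1 (by positivity)).trans (le_of_eq ?_)
    push_cast
    field_simp
    norm_num
  calc stepSize s * (1 + 2 * stepSize s) * (1 + 4 * ((s + 2 : ℕ) : ℝ) * stepSize s)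
      ≤ stepSize s * (1 + 1 / (4 * ((s : ℝ) + 2))) * (1 + 1 / (4 * ((s : ℝ) + 2))) := by gcongr
    _ ≤ _ := by
      rw [stepSize]
      have e : (1 : ℝ) + 1 / (4 * ((s : ℝ) + 2)) = (4 * (s + 2) + 1) / (4 * (s + 2)) := by
        field_simp
      rw [e, div_mul_div_comm, div_mul_div_comm, div_le_div_iff₀ (by positivity) (by positivity)]
      have : ((s : ℝ) + 1) * (4 * (s + 2) + 1) * (4 * (s + 2) + 1)
          ≤ (s + 2) * (4 * (s + 2)) * (4 * (s + 2)) := by nlinarith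
      calc ((s : ℝ) + 1) * (4 * (s + 2) + 1) * (4 * (s + 2) + 1) * (16 * (s + 2) ^ 2)
          ≤ (s + 2) * (4 * (s + 2)) * (4 * (s + 2)) * (16 * (s + 2) ^ 2) := by gcongr
        _ = _ := by ring

/-- The state of the normalization after `s` steps. -/
def IsNormalized (a : ℕ → ℝ) (ρ₀ : ℝ) (s : ℕ) (v : Fin n → MvPowerSeries (Fin n) ℂ) : Prop :=
  (∀ j, v j ∈ orderIdeal _ (s + 2)) ∧
    ∀ j, wnorm (ENNReal.ofReal (radius a ρ₀ s)) (v j) ≤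
      ENNReal.ofReal (1 / (16 * ((s : ℝ) + 1) ^ 2) * a s * radius a ρ₀ s)

theorem IsNormalized.exists_succ {lam : Fin n → ℂ} (hlam : ∀ j, lam j ≠ 0) {a : ℕ → ℝ}
    (hpos : ∀ r, 0 < a r) (hle : ∀ r, a r ≤ 1) (hanti : Antitone a)
    (ha : ∀ r, 1 ≤ r → ∀ (k : Fin n →₀ ℕ) (j : Fin n), k.degree = r + 1 →
      a r ≤ ‖(∏ i, lam i ^ k i) * (lam j)⁻¹ - 1‖)
    {ρ₀ : ℝ} (hρ : 0 < ρ₀) {s : ℕ} {v : Fin n → MvPowerSeries (Fin n) ℂ}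
    (hv : IsNormalized a ρ₀ s v) :
    ∃ U v' : Fin n → MvPowerSeries (Fin n) ℂ, IsNormalized a ρ₀ (s + 1) v' ∧
      (∀ j, U j ∈ orderIdeal _ (s + 2)) ∧
      (∀ j, subst (linMul lam v) (nearId U j) = subst (nearId U) (linMul lam v' j)) ∧
      (∀ j, wnorm (ENNReal.ofReal ((1 + 2 * stepSize s) * radius a ρ₀ (s + 1))) (U j) ≤
        ENNReal.ofReal (stepSize s * ((1 + 2 * stepSize s) * radius a ρ₀ (s + 1)))) := by
  have hη := stepSize_nonneg s
  have hρs := radius_pos a hρ s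
  have hρs' := radius_pos a hρ (s + 1)
  have hrad : (1 + 2 * ENNReal.ofReal (stepSize s)) * ENNReal.ofReal (radius a ρ₀ (s + 1))
      = ENNReal.ofReal ((1 + 2 * stepSize s) * radius a ρ₀ (s + 1)) := by
    rw [ENNReal.ofReal_mul (by positivity), ENNReal.ofReal_add zero_le_one (by positivity),
      ENNReal.ofReal_mul zero_le_two]
    simp
  obtain ⟨U, v', hU, hv', hconj, hUn, hvn'⟩ := exists_step hlam (Nat.le_add_left 1 s)
    (α := ENNReal.ofReal (a (s + 1))) (η := ENNReal.ofReal (stepSize s))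
    (ρ := ENNReal.ofReal (radius a ρ₀ (s + 1))) (by simpa using hpos (s + 1))
    (ENNReal.ofReal_le_one.2 (hle _))
    (fun k j hk => by
      rw [← ofReal_norm]
      exact ENNReal.ofReal_le_ofReal (ha (s + 1) (Nat.le_add_left 1 s) k j hk))
    (by
      rw [show (2 : ℝ≥0∞) = ENNReal.ofReal 2 by simp, ← ENNReal.ofReal_mul zero_le_two]
      refine ENNReal.ofReal_le_one.2 ?_
      have h1 := stepSize_le s
      have h2 : 1 / (16 * ((s : ℝ) + 2) ^ 2) ≤ 1 / 2 := by
        apply one_div_le_one_div_of_le (by norm_num)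
        have : (0 : ℝ) ≤ s := s.cast_nonneg
        nlinarith
      linarith)
    (by
      rw [← ENNReal.ofReal_one, ← ENNReal.ofReal_add zero_le_one hη,
        ← ENNReal.ofReal_pow (by positivity), show (2 : ℝ≥0∞) = ENNReal.ofReal 2 by simp]
      exact ENNReal.ofReal_le_ofReal (one_add_stepSize_pow_le s))
    hv.1
    -- The order `s + 2` yields `s + 2` powers of the ratio. One of them goes into the shrunken
    -- radius on the right, so the relative size gains the power `s + 1`.
    (fun j => by
      rw [hrad, radius_succ, ENNReal.ofReal_mul (Real.exp_pos _).le]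
      refine (wnorm_mul_radius_le (ENNReal.ofReal_le_one.2
        (Real.exp_le_one_iff.2 (logRatio_nonpos hpos hanti s))) (hv.1 j)).trans ?_
      refine (mul_le_mul_right (hv.2 j) _).trans (le_of_eq ?_)
      rw [← ENNReal.ofReal_pow (Real.exp_pos _).le, ← ENNReal.ofReal_mul (by positivity),
        ← ENNReal.ofReal_mul hη, ← ENNReal.ofReal_mul (Real.exp_pos _).le,
        ← ENNReal.ofReal_mul (mul_nonneg hη (hpos _).le)]
      congr 1
      have h := exp_logRatio_pow hpos s
      calc Real.exp (logRatio a s) ^ (s + 2) *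
            (1 / (16 * ((s : ℝ) + 1) ^ 2) * a s * radius a ρ₀ s)
          = (Real.exp (logRatio a s) ^ (s + 1) * a s) * (1 / (16 * ((s : ℝ) + 1) ^ 2)) *
            (Real.exp (logRatio a s) * radius a ρ₀ s) := by ring
        _ = _ := by
          rw [h, stepSize]
          field_simp)
  rw [hrad] at hUn
  refine ⟨U, v', ⟨hv', fun j => (hvn' j).trans ?_⟩, hU, hconj, fun j => (hUn j).trans ?_⟩
  · have e : (1 + 4 * ((s + 1 + 1 : ℕ) : ℝ≥0∞) * ENNReal.ofReal (stepSize s))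
        = ENNReal.ofReal (1 + 4 * ((s + 2 : ℕ) : ℝ) * stepSize s) := by
      rw [ENNReal.ofReal_add zero_le_one (by positivity), ENNReal.ofReal_mul (by positivity),
        ENNReal.ofReal_mul (by positivity), ENNReal.ofReal_natCast]
      simp
      ring
    have e' : (1 + 2 * ENNReal.ofReal (stepSize s)) = ENNReal.ofReal (1 + 2 * stepSize s) := by
      rw [ENNReal.ofReal_add zero_le_one (by positivity), ENNReal.ofReal_mul zero_le_two]
      simp
    rw [e, e', ← ENNReal.ofReal_mul (by positivity), ← ENNReal.ofReal_mul (by positivity),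
      ← ENNReal.ofReal_mul (by positivity),
      ← ENNReal.ofReal_mul (mul_nonneg (by positivity) (hpos _).le)]
    refine ENNReal.ofReal_le_ofReal ?_
    have := (hpos (s + 1)).le
    push_cast
    rw [show (s : ℝ) + 1 + 1 = s + 2 by ring]
    gcongr
    have h := stepSize_mul_le s
    push_cast at h
    exact h
  · rw [ENNReal.ofReal_mul hη]

/-- Formal linearization with a bound for the conjugating transformation. -/
theorem exists_formal_linearization {lam : Fin n → ℂ} (hlam : ∀ j, lam j ≠ 0) {a : ℕ → ℝ}
    (h0 : a 0 = 1) (hpos : ∀ r, 0 < a r) (hanti : Antitone a)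
    (ha : ∀ r, 1 ≤ r → ∀ (k : Fin n →₀ ℕ) (j : Fin n), k.degree = r + 1 →
      a r ≤ ‖(∏ i, lam i ^ k i) * (lam j)⁻¹ - 1‖) {Γ : ℝ}
    (hΓ : HasSum (fun r : ℕ => -Real.log (a (r + 1)) / (((r : ℝ) + 1) * ((r : ℝ) + 2))) Γ)
    {ρ₀ : ℝ} (hρ : 0 < ρ₀) {v : Fin n → MvPowerSeries (Fin n) ℂ}
    (hv : ∀ j, v j ∈ orderIdeal _ 2)
    (hvn : ∀ j, wnorm (ENNReal.ofReal ρ₀) (v j) ≤ ENNReal.ofReal (ρ₀ / 16)) :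
    ∃ Φ : Fin n → MvPowerSeries (Fin n) ℂ, (∀ j, Φ j - X j ∈ orderIdeal _ 2) ∧
      (∀ j, subst (linMul lam v) (Φ j) = lam j • Φ j) ∧
      ∀ j, wnorm (ENNReal.ofReal (ρ₀ * Real.exp (-8) * Real.exp (-Γ) / 2)) (Φ j) ≤
        ENNReal.ofReal (ρ₀ * Real.exp (-8) * Real.exp (-Γ)) := by
  have hle : ∀ r, a r ≤ 1 := fun r => h0 ▸ hanti (Nat.zero_le r)
  have hstart : IsNormalized a ρ₀ 0 v := by
    refine ⟨hv, fun j => ?_⟩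
    refine (hvn j).trans (le_of_eq ?_)
    rw [h0, radius]
    congr 1
    norm_num
    ring
  choose U v' hv' hU hconj hUn using
    fun (s : ℕ) (v : {v : Fin n → MvPowerSeries (Fin n) ℂ // IsNormalized a ρ₀ s v}) =>
      v.2.exists_succ hlam hpos hle hanti ha hρ
  let V : ∀ s, {v : Fin n → MvPowerSeries (Fin n) ℂ // IsNormalized a ρ₀ s v} := fun s =>
    Nat.rec ⟨v, hstart⟩ (fun s w => ⟨v' s w, hv' s w⟩) s
  have hV0 : (V 0).1 = v := rfl
  have hVs : ∀ s, (V (s + 1)).1 = v' s (V s) := fun _ => rfl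
  -- `Φ s` is `(id + U_{s-1}) ∘ ⋯ ∘ (id + U_0)`, so that `Φ_s ∘ F = F_s ∘ Φ_s` for the map `F_s`
  -- reached after `s` steps.
  obtain ⟨Φ, hΦ0, hΦs⟩ : ∃ Φ : ℕ → Fin n → MvPowerSeries (Fin n) ℂ, Φ 0 = X ∧
      ∀ s, Φ (s + 1) = fun j => subst (Φ s) (nearId (U s (V s)) j) :=
    ⟨fun s => Nat.rec X (fun s φ j => subst φ (nearId (U s (V s)) j)) s, rfl, fun _ => rfl⟩
  have hU1 : ∀ s j, nearId (U s (V s)) j ∈ orderIdeal _ 1 := fun s =>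
    nearId_mem (Nat.le_add_left 1 (s + 1)) (hU s (V s))
  have hΦ1 : ∀ s j, Φ s j ∈ orderIdeal _ 1 := by
    intro s
    induction s with
    | zero => rw [hΦ0]; exact X_mem_orderIdeal
    | succ s ih => rw [hΦs]; exact fun j => subst_mem_orderIdeal ih (hU1 s j)
  have hΦ_succ : ∀ s j, Φ (s + 1) j = Φ s j + subst (Φ s) (U s (V s) j) := fun s j => by
    rw [hΦs]
    exact subst_nearId_apply (hΦ1 s) _ j
  have hlin1 : ∀ s j, linMul lam (V s).1 j ∈ orderIdeal _ 1 := fun s =>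
    linMul_mem lam (Nat.le_add_left 1 (s + 1)) (V s).2.1
  have hF1 : ∀ j, linMul lam v j ∈ orderIdeal _ 1 := hlin1 0
  have hcomm : ∀ s j, subst (linMul lam v) (Φ s j) = subst (Φ s) (linMul lam (V s).1 j) := by
    intro s
    induction s with
    | zero =>
      intro j
      rw [hΦ0, subst_X (hasSubst_of_mem hF1), subst_self, id, hV0]
    | succ s ih =>
      intro j
      have e1 := subst_comp_subst_apply (hasSubst_of_mem (hΦ1 s)) (hasSubst_of_mem hF1)
        (nearId (U s (V s)) j)
      have e2 := subst_comp_subst_apply (hasSubst_of_mem (hlin1 s)) (hasSubst_of_mem (hΦ1 s))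
        (nearId (U s (V s)) j)
      have e3 := subst_comp_subst_apply (hasSubst_of_mem (hU1 s)) (hasSubst_of_mem (hΦ1 s))
        (linMul lam (V (s + 1)).1 j)
      rw [hΦs]
      simp only
      rw [e1, funext ih, ← e2, hconj, ← hVs, e3]
  -- `2R` lies below the radius of every domain, so each `U_s` can be evaluated as long as `Φ_s` at
  -- most doubles the radius `R`.
  set R := ρ₀ * Real.exp (-8) * Real.exp (-Γ) / 2 with hR
  have hRpos : 0 < R := by positivity
  have hRle : ∀ s, 2 * R ≤ (1 + 2 * stepSize s) * radius a ρ₀ (s + 1) := by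
    intro s
    have h1 := le_radius h0 hρ (s + 1)
    have h2 := lossExp_le hpos hle hanti hΓ (s + 1)
    have h3 := stepSize_nonneg s
    have h4 := radius_pos a hρ (s + 1)
    calc 2 * R = ρ₀ * Real.exp (-8) * Real.exp (-Γ) := by rw [hR]; ring
      _ ≤ ρ₀ * Real.exp (-8) * Real.exp (-lossExp a (s + 1)) := by gcongr
      _ ≤ 1 * radius a ρ₀ (s + 1) := by rwa [one_mul]
      _ ≤ _ := by gcongr; linarith
  -- The increments are at most `2R * stepSize s`, which is dominated by the telescoping difference
  -- `R(1/(s+1) - 1/(s+2))`.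
  have hΦn : ∀ s j, wnorm (ENNReal.ofReal R) (Φ s j) ≤
      ENNReal.ofReal (R * (2 - 1 / ((s : ℝ) + 1))) := by
    intro s
    induction s with
    | zero =>
      intro j
      rw [hΦ0, wnorm_X]
      norm_num
    | succ s ih =>
      intro j
      have hη := stepSize_nonneg s
      set ρ' := (1 + 2 * stepSize s) * radius a ρ₀ (s + 1) with hρ'
      have hρpos : 0 < ρ' := by
        have := radius_pos a hρ (s + 1)
        positivity
      set c := R * (2 - 1 / ((s : ℝ) + 1)) with hc
      have h1 : 1 / ((s : ℝ) + 1) ≤ 1 := by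
        rw [div_le_one (by positivity)]
        linarith [(s.cast_nonneg : (0 : ℝ) ≤ s)]
      have hcpos : 0 ≤ c := mul_nonneg hRpos.le (by linarith)
      have hcle : c ≤ ρ' := by
        refine le_trans ?_ (hRle s)
        rw [hc, mul_comm 2]
        gcongr
        have : 0 ≤ 1 / ((s : ℝ) + 1) := by positivity
        linarith
      have hdiv : c / ρ' ≤ 1 := (div_le_one hρpos).2 hcle
      -- `U_s` is restricted from radius `ρ'` to `c`; order one is enough here, as it makes the
      -- bound scale linearly and keeps the relative size `stepSize s`.
      have hsub : wnorm (ENNReal.ofReal R) (subst (Φ s) (U s (V s) j)) ≤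
          ENNReal.ofReal (stepSize s * c) := by
        refine (wnorm_subst_le (hΦ1 s) ih _).trans ?_
        have e : ENNReal.ofReal c = ENNReal.ofReal (c / ρ') * ENNReal.ofReal ρ' := by
          rw [← ENNReal.ofReal_mul (by positivity), div_mul_cancel₀ _ hρpos.ne']
        rw [e]
        refine (wnorm_mul_radius_le (m := 1) (ENNReal.ofReal_le_one.2 hdiv)
          (orderIdeal_anti (Nat.le_add_left 1 (s + 1)) (hU s (V s) j))).trans ?_
        rw [pow_one]
        refine (mul_le_mul_right (hUn s (V s) j) _).trans (le_of_eq ?_)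
        rw [← ENNReal.ofReal_mul (by positivity)]
        congr 1
        rw [mul_left_comm, div_mul_cancel₀ _ hρpos.ne']
      rw [hΦ_succ]
      refine ((wnorm_add_le _ _).trans (add_le_add (ih j) hsub)).trans ?_
      rw [← ENNReal.ofReal_add hcpos (mul_nonneg hη hcpos)]
      refine ENNReal.ofReal_le_ofReal ?_
      have h2 : 2 * stepSize s ≤ 1 / ((s : ℝ) + 1) - 1 / ((s : ℝ) + 2) := by
        have e : 1 / ((s : ℝ) + 1) - 1 / ((s : ℝ) + 2) = 1 / (((s : ℝ) + 1) * ((s : ℝ) + 2)) := by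
          field_simp
          ring
        rw [e]
        refine (mul_le_mul_of_nonneg_left (stepSize_le s) zero_le_two).trans ?_
        rw [mul_one_div, div_le_div_iff₀ (by positivity) (by positivity)]
        nlinarith [(s.cast_nonneg : (0 : ℝ) ≤ s)]
      have h3 : stepSize s * c ≤ stepSize s * (R * 2) := by
        rw [hc]
        gcongr
        have : 0 ≤ 1 / ((s : ℝ) + 1) := by positivity
        linarith
      push_cast
      rw [show (s : ℝ) + 1 + 1 = s + 2 by ring]
      calc c + stepSize s * c ≤ R * (2 - 1 / ((s : ℝ) + 1)) + R * (2 * stepSize s) := by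
            rw [← hc]; linarith
        _ ≤ R * (2 - 1 / ((s : ℝ) + 1)) + R * (1 / ((s : ℝ) + 1) - 1 / ((s : ℝ) + 2)) := by gcongr
        _ = _ := by ring
  have hdiff : ∀ s j, Φ (s + 1) j - Φ s j ∈ orderIdeal _ (s + 2) := fun s j => by
    rw [hΦ_succ, add_sub_cancel_left]
    exact subst_mem_orderIdeal (hΦ1 s) (hU s (V s) j)
  choose Ψ hΨ hΨn using fun j => exists_formal_limit (fun s => Φ s j)
    fun s => orderIdeal_anti (Nat.le_succ _) (hdiff s j)
  refine ⟨Ψ, fun j => ?_, fun j => eq_of_forall_sub_mem fun m => ?_, fun j => hΨn j _ _ fun s => ?_⟩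
  · have := add_mem (hΨ j 1) (hdiff 0 j)
    rwa [hΦ0, sub_add_sub_cancel] at this
  · have hsF := hasSubst_of_mem hF1
    have e1 := subst_mem_orderIdeal hF1 (hΨ j m)
    rw [subst_sub hsF, hcomm] at e1
    -- Modulo order `m` the remainder `v_m ∘ Φ_m` vanishes and `Φ_m` agrees with the limit, so the
    -- conjugacy relation passes to the limit.
    have e2 : subst (Φ m) (linMul lam (V m).1 j) = lam j • (Φ m j + subst (Φ m) ((V m).1 j)) := by
      rw [linMul, subst_smul (hasSubst_of_mem (hΦ1 m)), subst_nearId_apply (hΦ1 m)]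
    have e3 : lam j • (subst (Φ m) ((V m).1 j) - (Ψ j - Φ m j)) ∈ orderIdeal _ m :=
      Submodule.smul_of_tower_mem _ _ (sub_mem
        (subst_mem_orderIdeal (hΦ1 m) (orderIdeal_anti (by omega) ((V m).2.1 j)))
        (orderIdeal_anti (by omega) (hΨ j m)))
    have e4 := add_mem (orderIdeal_anti (Nat.le_succ m) e1) e3
    rw [e2] at e4
    convert e4 using 1
    simp only [smul_add, smul_sub]
    ring
  · refine (hΦn s j).trans (ENNReal.ofReal_le_ofReal ?_)
    have : 0 ≤ 1 / ((s : ℝ) + 1) := by positivity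
    calc R * (2 - 1 / ((s : ℝ) + 1)) ≤ R * 2 := by gcongr; linarith
      _ = _ := by rw [hR]; ring

end Iteration

/-! ### From formal series to analytic functions -/

section Evaluation

variable {n : ℕ}

/-- The multi-indices of degree `m`. -/
noncomputable def indices (n m : ℕ) : Finset (Fin n →₀ ℕ) :=
  (univ : Finset (Fin n)).finsuppAntidiag m

theorem mem_indices {m : ℕ} {k : Fin n →₀ ℕ} : k ∈ indices n m ↔ k.degree = m := by
  rw [indices, mem_finsuppAntidiag, Finsupp.degree_eq_sum]
  simp

/-- Summation by degree. -/
theorem hasSum_indices {E : Type*} [AddCommMonoid E] [TopologicalSpace E] [ContinuousAdd E]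
    [RegularSpace E] {F : (Fin n →₀ ℕ) → E} {a : E} (h : HasSum F a) :
    HasSum (fun m => ∑ k ∈ indices n m, F k) a := by
  have h1 := (Equiv.sigmaFiberEquiv (Finsupp.degree : (Fin n →₀ ℕ) → ℕ)).hasSum_iff.2 h
  refine h1.sigma fun m => ?_
  let _ : Fintype {k : Fin n →₀ ℕ // k.degree = m} := Fintype.subtype (indices n m)
    fun _ => mem_indices
  rw [Finset.sum_subtype (indices n m) (fun _ => mem_indices) F]
  exact hasSum_fintype _

theorem wnorm_eq_tsum_indices (ρ : ℝ≥0∞) (g : MvPowerSeries (Fin n) ℂ) :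
    wnorm ρ g = ∑' m, (∑ k ∈ indices n m, ‖coeff k g‖ₑ) * ρ ^ m := by
  rw [wnorm, ← (hasSum_indices ENNReal.summable.hasSum).tsum_eq]
  refine tsum_congr fun m => ?_
  rw [Finset.sum_mul]
  exact Finset.sum_congr rfl fun k hk => by rw [mem_indices.1 hk]

/-- The value at `x` of the monomial with exponent `k`. -/
def monoAt (x : Fin n → ℂ) (k : Fin n →₀ ℕ) : ℂ := ∏ i, x i ^ k i

theorem monoAt_zero (x : Fin n → ℂ) : monoAt x 0 = 1 := by simp [monoAt]

theorem monoAt_add (x : Fin n → ℂ) (k l : Fin n →₀ ℕ) :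
    monoAt x (k + l) = monoAt x k * monoAt x l := by
  simp [monoAt, pow_add, Finset.prod_mul_distrib]

theorem monoAt_single (x : Fin n → ℂ) (i : Fin n) : monoAt x (Finsupp.single i 1) = x i := by
  rw [monoAt, Finset.prod_eq_single i]
  · simp
  · intro j _ hj
    simp [Finsupp.single_eq_of_ne hj]
  · simp

theorem enorm_monoAt_le {x : Fin n → ℂ} {ρ : ℝ≥0∞} (hx : ∀ i, ‖x i‖ₑ ≤ ρ) {m : ℕ}
    {k : Fin n →₀ ℕ} (hk : k.degree = m) : ‖monoAt x k‖ₑ ≤ ρ ^ m := by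
  induction m generalizing k with
  | zero =>
    obtain rfl : k = 0 := (Finsupp.degree_eq_zero_iff _).1 hk
    simp [monoAt_zero]
  | succ m ih =>
    obtain ⟨e, i, rfl, he⟩ := exists_eq_add_single hk
    rw [monoAt_add, monoAt_single, enorm_mul, pow_succ]
    exact mul_le_mul' (ih he) (hx i)

/-- The value at `x` of a formal power series. -/
noncomputable def evalAt (x : Fin n → ℂ) (g : MvPowerSeries (Fin n) ℂ) : ℂ :=
  ∑' k, coeff k g * monoAt x k

variable {x : Fin n → ℂ} {ρ : ℝ≥0∞}

theorem tsum_enorm_le_wnorm (hx : ∀ i, ‖x i‖ₑ ≤ ρ) (g : MvPowerSeries (Fin n) ℂ) :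
    ∑' k, ‖coeff k g * monoAt x k‖ₑ ≤ wnorm ρ g :=
  ENNReal.tsum_le_tsum fun k => by
    rw [enorm_mul]
    gcongr
    exact enorm_monoAt_le hx rfl

theorem summable_norm_of_wnorm (hx : ∀ i, ‖x i‖ₑ ≤ ρ) {g : MvPowerSeries (Fin n) ℂ}
    (hg : wnorm ρ g ≠ ⊤) : Summable fun k => ‖coeff k g * monoAt x k‖ :=
  tsum_enorm_ne_top_iff_summable_norm.1 (ne_top_of_le_ne_top hg (tsum_enorm_le_wnorm hx g))

theorem hasSum_evalAt (hx : ∀ i, ‖x i‖ₑ ≤ ρ) {g : MvPowerSeries (Fin n) ℂ}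
    (hg : wnorm ρ g ≠ ⊤) : HasSum (fun k => coeff k g * monoAt x k) (evalAt x g) :=
  (summable_norm_of_wnorm hx hg).of_norm.hasSum

theorem enorm_evalAt_le (hx : ∀ i, ‖x i‖ₑ ≤ ρ) (g : MvPowerSeries (Fin n) ℂ) :
    ‖evalAt x g‖ₑ ≤ wnorm ρ g := enorm_tsum_le_tsum_enorm.trans (tsum_enorm_le_wnorm hx g)

theorem evalAt_X (i : Fin n) : evalAt x (X i) = x i := by
  classical
  rw [evalAt, tsum_eq_single (Finsupp.single i 1)]
  · simp [monoAt_single, coeff_X]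
  · intro k hk
    simp [coeff_X, hk]

theorem evalAt_one : evalAt x 1 = 1 := by
  classical
  rw [evalAt, tsum_eq_single 0]
  · simp [monoAt_zero]
  · intro k hk
    simp [coeff_one, hk]

theorem evalAt_smul (c : ℂ) (g : MvPowerSeries (Fin n) ℂ) :
    evalAt x (c • g) = c * evalAt x g := by
  rw [evalAt, evalAt, ← tsum_mul_left]
  exact tsum_congr fun k => by rw [coeff_smul, mul_assoc]

theorem evalAt_add (hx : ∀ i, ‖x i‖ₑ ≤ ρ) {f g : MvPowerSeries (Fin n) ℂ}
    (hf : wnorm ρ f ≠ ⊤) (hg : wnorm ρ g ≠ ⊤) :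
    evalAt x (f + g) = evalAt x f + evalAt x g := by
  have := (hasSum_evalAt hx hf).add (hasSum_evalAt hx hg)
  rw [← this.tsum_eq, evalAt]
  exact tsum_congr fun k => by rw [map_add, add_mul]

theorem evalAt_mul (hx : ∀ i, ‖x i‖ₑ ≤ ρ) {f g : MvPowerSeries (Fin n) ℂ}
    (hf : wnorm ρ f ≠ ⊤) (hg : wnorm ρ g ≠ ⊤) :
    evalAt x (f * g) = evalAt x f * evalAt x g := by
  have h1 := summable_norm_of_wnorm hx hf
  have h2 := summable_norm_of_wnorm hx hg
  have h4 := summable_mul_of_summable_norm h1 h2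
  have h3 := Summable.tsum_mul_tsum_eq_tsum_sum_antidiagonal h1.of_norm h2.of_norm h4
  rw [evalAt, evalAt, evalAt, h3]
  refine tsum_congr fun k => ?_
  rw [coeff_mul, Finset.sum_mul]
  refine Finset.sum_congr rfl fun p hp => ?_
  have hk : monoAt x k = monoAt x p.1 * monoAt x p.2 := by
    rw [← monoAt_add, HasAntidiagonal.mem_antidiagonal.1 hp]
  rw [hk]
  exact mul_mul_mul_comm _ _ _ _

theorem evalAt_mono (hx : ∀ i, ‖x i‖ₑ ≤ ρ) {a : Fin n → MvPowerSeries (Fin n) ℂ} {ρ' : ℝ≥0∞}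
    (hρ' : ρ' ≠ ⊤) (ha : ∀ i, wnorm ρ (a i) ≤ ρ') {m : ℕ} {d : Fin n →₀ ℕ} (hd : d.degree = m) :
    evalAt x (mono a d) = monoAt (fun i => evalAt x (a i)) d := by
  induction m generalizing d with
  | zero =>
    obtain rfl : d = 0 := (Finsupp.degree_eq_zero_iff _).1 hd
    rw [mono_zero, monoAt_zero, evalAt_one]
  | succ m ih =>
    obtain ⟨e, i, rfl, he⟩ := exists_eq_add_single hd
    rw [mono_add, mono_single, monoAt_add, monoAt_single, ← ih he]
    exact evalAt_mul hx (ne_top_of_le_ne_top (ENNReal.pow_ne_top hρ') (wnorm_mono_le ha he))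
      (ne_top_of_le_ne_top hρ' (ha i))

/-- Evaluation is compatible with substitution. -/
theorem evalAt_subst (hx : ∀ i, ‖x i‖ₑ ≤ ρ) {a : Fin n → MvPowerSeries (Fin n) ℂ} {ρ' : ℝ≥0∞}
    (hρ' : ρ' ≠ ⊤) (ha : ∀ i, wnorm ρ (a i) ≤ ρ') (ha1 : ∀ i, a i ∈ orderIdeal _ 1)
    {g : MvPowerSeries (Fin n) ℂ} (hg : wnorm ρ' g ≠ ⊤) :
    evalAt x (subst a g) = evalAt (fun i => evalAt x (a i)) g := by
  -- Absolute summability of the double family, controlled by `wnorm ρ' g`, justifies exchanging the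
  -- two sums.
  have hsum : Summable (Function.uncurry fun d k : Fin n →₀ ℕ =>
      coeff d g * coeff k (mono a d) * monoAt x k) := by
    refine Summable.of_enorm (ne_top_of_le_ne_top hg ?_)
    rw [ENNReal.tsum_prod']
    refine ENNReal.tsum_le_tsum fun d => ?_
    simp only [Function.uncurry_apply_pair, enorm_mul, mul_assoc]
    rw [ENNReal.tsum_mul_left]
    gcongr
    refine le_trans ?_ (wnorm_mono_le ha rfl)
    simp_rw [← enorm_mul]
    exact tsum_enorm_le_wnorm hx _
  calc evalAt x (subst a g)
      = ∑' k, ∑' d, coeff d g * coeff k (mono a d) * monoAt x k := by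
        refine tsum_congr fun k => ?_
        rw [coeff_subst_eq_finsum ha1, ← tsum_eq_finsum (L := .unconditional _)
          (coeff_mono_support ha1 g k), tsum_mul_right]
    _ = ∑' d, ∑' k, coeff d g * coeff k (mono a d) * monoAt x k := hsum.tsum_comm
    _ = _ := by
        refine tsum_congr fun d => ?_
        simp_rw [mul_assoc]
        rw [tsum_mul_left, ← evalAt_mono hx hρ' ha rfl]
        rfl

/-- A monomial of degree `m` is the diagonal of a multilinear map of norm at most one. -/
theorem exists_multilinear_monoAt {m : ℕ} {k : Fin n →₀ ℕ} (hk : k.degree = m) :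
    ∃ M : ContinuousMultilinearMap ℂ (fun _ : Fin m => (Fin n → ℂ)) ℂ,
      ‖M‖ ≤ 1 ∧ ∀ x, M (fun _ => x) = monoAt x k := by
  have hind : ∃ l : Fin m → Fin n, ∀ x : Fin n → ℂ, ∏ i, x (l i) = monoAt x k := by
    induction m generalizing k with
    | zero =>
      obtain rfl : k = 0 := (Finsupp.degree_eq_zero_iff _).1 hk
      exact ⟨Fin.elim0, fun x => by simp [monoAt_zero]⟩
    | succ m ih =>
      obtain ⟨e, i, rfl, he⟩ := exists_eq_add_single hk
      obtain ⟨l, hl⟩ := ih he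
      refine ⟨Fin.cons i l, fun x => ?_⟩
      rw [Fin.prod_univ_succ, monoAt_add, monoAt_single, mul_comm]
      simp [hl]
  obtain ⟨l, hl⟩ := hind
  refine ⟨(ContinuousMultilinearMap.mkPiAlgebra ℂ (Fin m) ℂ).compContinuousLinearMap
    fun i => ContinuousLinearMap.proj (l i),
    ContinuousMultilinearMap.opNorm_le_bound zero_le_one fun y => ?_, fun x => ?_⟩
  · simp only [ContinuousMultilinearMap.compContinuousLinearMap_apply,
      ContinuousMultilinearMap.mkPiAlgebra_apply, ContinuousLinearMap.proj_apply, one_mul, norm_prod]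
    exact Finset.prod_le_prod (fun _ _ => norm_nonneg _) fun i _ => norm_le_pi_norm (y i) (l i)
  · simp [hl]

theorem enorm_le_of_mem_closedBall {r : ℝ} {y : Fin n → ℂ} (hy : ‖y‖ ≤ r) (i : Fin n) :
    ‖y i‖ₑ ≤ ENNReal.ofReal r := by
  rw [← ofReal_norm]
  exact ENNReal.ofReal_le_ofReal ((norm_le_pi_norm y i).trans hy)

/-- A formal power series with finite norm is analytic on the polydisk. -/
theorem analyticOnNhd_evalAt {r : ℝ≥0} (hr : 0 < r) {g : MvPowerSeries (Fin n) ℂ}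
    (hg : wnorm r g ≠ ⊤) : AnalyticOnNhd ℂ (fun x => evalAt x g) (Metric.ball 0 r) := by
  have hM : ∀ k : Fin n →₀ ℕ, ∃ M : ∀ m, ContinuousMultilinearMap ℂ
      (fun _ : Fin m => (Fin n → ℂ)) ℂ, ∀ m, k.degree = m →
        ‖M m‖ ≤ 1 ∧ ∀ x, M m (fun _ => x) = monoAt x k := by
    intro k
    have : ∀ m, ∃ M : ContinuousMultilinearMap ℂ (fun _ : Fin m => (Fin n → ℂ)) ℂ,
        k.degree = m → ‖M‖ ≤ 1 ∧ ∀ x, M (fun _ => x) = monoAt x k := by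
      intro m
      by_cases h : k.degree = m
      · obtain ⟨M, hM⟩ := exists_multilinear_monoAt h
        exact ⟨M, fun _ => hM⟩
      · exact ⟨0, fun h' => absurd h' h⟩
    choose M hM using this
    exact ⟨M, hM⟩
  choose M hM using hM
  -- Each monomial of degree `m` is a multilinear form of norm at most one for the sup norm, so `‖p
  -- m‖` is bounded by the `ℓ¹` norm of the degree-`m` coefficients.
  let p : FormalMultilinearSeries ℂ (Fin n → ℂ) ℂ :=
    fun m => ∑ k ∈ indices n m, coeff k g • M k m
  have hp : HasFPowerSeriesOnBall (fun x => evalAt x g) p 0 r := by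
    refine ⟨p.le_radius_of_summable_norm ?_, by exact_mod_cast hr, fun {y} hy => ?_⟩
    · have h1 : Summable fun m => (∑ k ∈ indices n m, ‖coeff k g‖ * (r : ℝ) ^ k.degree) := by
        refine (hasSum_indices (Summable.hasSum ?_)).summable
        have : Summable fun k => ‖coeff k g * ((r : ℝ) : ℂ) ^ k.degree‖ := by
          rw [← tsum_enorm_ne_top_iff_summable_norm]
          convert hg using 1
          refine tsum_congr fun k => ?_
          rw [enorm_mul, enorm_pow]
          congr 2
          rw [← ofReal_norm]
          simp
        simpa using this
      refine h1.of_nonneg_of_le (fun m => by positivity) fun m => ?_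
      calc ‖p m‖ * (r : ℝ) ^ m ≤ (∑ k ∈ indices n m, ‖coeff k g‖) * (r : ℝ) ^ m := by
            gcongr
            refine (norm_sum_le _ _).trans (Finset.sum_le_sum fun k hk => ?_)
            rw [norm_smul]
            exact mul_le_of_le_one_right (norm_nonneg _) (hM k m (mem_indices.1 hk)).1
        _ = _ := by
            rw [Finset.sum_mul]
            exact Finset.sum_congr rfl fun k hk => by rw [mem_indices.1 hk]
    · rw [zero_add]
      have hy' : ∀ i, ‖y i‖ₑ ≤ (r : ℝ≥0∞) := fun i => by
        rw [mem_eball_zero_iff] at hy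
        refine le_trans ?_ hy.le
        rw [← ofReal_norm, ← ofReal_norm]
        exact ENNReal.ofReal_le_ofReal (norm_le_pi_norm y i)
      have e : (fun m => p m fun _ => y) =
          fun m => ∑ k ∈ indices n m, coeff k g * monoAt y k := by
        funext m
        change (∑ k ∈ indices n m, coeff k g • M k m) (fun _ => y) = _
        simp only [_root_.sum_apply, _root_.smul_apply, smul_eq_mul]
        exact Finset.sum_congr rfl fun k hk => by rw [(hM k m (mem_indices.1 hk)).2]
      rw [e]
      exact hasSum_indices (hasSum_evalAt hy' hg)
  have := hp.analyticOnNhd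
  rwa [Metric.eball_coe] at this

end Evaluation

/-! ### The expansion of the map and the size of its nonlinearity -/

section Expansion

variable {n : ℕ}

theorem eval_eq_sum_indices {P : MvPolynomial (Fin n) ℂ} {m : ℕ} (hP : P.IsHomogeneous m)
    (x : Fin n → ℂ) : MvPolynomial.eval x P = ∑ k ∈ indices n m, P.coeff k * monoAt x k := by
  rw [MvPolynomial.eval_eq']
  refine Finset.sum_subset (fun k hk => mem_indices.2 ?_) fun k _ hk => ?_
  · by_contra h
    exact MvPolynomial.mem_support_iff.1 hk (hP.coeff_eq_zero h)
  · rw [MvPolynomial.notMem_support_iff.1 hk, zero_mul]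

theorem monoAt_smul (z : ℂ) (x : Fin n → ℂ) (k : Fin n →₀ ℕ) :
    monoAt (z • x) k = z ^ k.degree * monoAt x k := by
  simp [monoAt, mul_pow, Finset.prod_mul_distrib, Finset.prod_pow_eq_pow_sum,
    Finsupp.degree_eq_sum]

theorem eval_smul_eq {P : MvPolynomial (Fin n) ℂ} {m : ℕ} (hP : P.IsHomogeneous m)
    (z : ℂ) (x : Fin n → ℂ) :
    MvPolynomial.eval (z • x) P = z ^ m * MvPolynomial.eval x P := by
  rw [eval_eq_sum_indices hP, eval_eq_sum_indices hP, Finset.mul_sum]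
  refine Finset.sum_congr rfl fun k hk => ?_
  rw [monoAt_smul, mem_indices.1 hk]
  ring

theorem wnorm_one_coe (P : MvPolynomial (Fin n) ℂ) :
    wnorm 1 (P : MvPowerSeries (Fin n) ℂ) = ∑ k ∈ P.support, ‖P.coeff k‖ₑ := by
  rw [wnorm, tsum_eq_sum (s := P.support)]
  · simp
  · intro k hk
    simp [MvPolynomial.notMem_support_iff.1 hk]

theorem ofReal_polyNorm (V : Fin n → MvPolynomial (Fin n) ℂ) :
    ENNReal.ofReal (polyNorm V) = ∑ j, wnorm 1 (V j : MvPowerSeries (Fin n) ℂ) := by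
  rw [polyNorm, ENNReal.ofReal_sum_of_nonneg fun j _ => Finset.sum_nonneg fun k _ => norm_nonneg _]
  refine Finset.sum_congr rfl fun j _ => ?_
  rw [ENNReal.ofReal_sum_of_nonneg fun k _ => norm_nonneg _, wnorm_one_coe]
  simp

/-- The formal power series `Λ⁻¹ (v₁ + v₂ + …)`. -/
noncomputable def formalSeries (lam : Fin n → ℂ) (v : ℕ → Fin n → MvPolynomial (Fin n) ℂ) :
    Fin n → MvPowerSeries (Fin n) ℂ :=
  fun j k => if 2 ≤ k.degree then (lam j)⁻¹ * (v (k.degree - 1) j).coeff k else 0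

theorem coeff_formalSeries (lam : Fin n → ℂ) (v : ℕ → Fin n → MvPolynomial (Fin n) ℂ)
    (j : Fin n) (k : Fin n →₀ ℕ) : coeff k (formalSeries lam v j) =
      if 2 ≤ k.degree then (lam j)⁻¹ * (v (k.degree - 1) j).coeff k else 0 := rfl

theorem coeff_formalSeries_of_mem (lam : Fin n → ℂ) (v : ℕ → Fin n → MvPolynomial (Fin n) ℂ)
    (j : Fin n) {s : ℕ} {k : Fin n →₀ ℕ} (hk : k ∈ indices n (s + 2)) :
    coeff k (formalSeries lam v j) = (invLinear lam (v (s + 1)) j).coeff k := by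
  rw [coeff_formalSeries, mem_indices.1 hk, if_pos (Nat.le_add_left 2 s), invLinear,
    MvPolynomial.coeff_C_mul]
  rfl

theorem formalSeries_mem (lam : Fin n → ℂ) (v : ℕ → Fin n → MvPolynomial (Fin n) ℂ)
    (j : Fin n) : formalSeries lam v j ∈ orderIdeal _ 2 := fun k hk => by
  rw [coeff_formalSeries, if_neg (not_le.2 hk)]

theorem coeff_formalSeries_eq_zero (lam : Fin n → ℂ) (v : ℕ → Fin n → MvPolynomial (Fin n) ℂ)
    (j : Fin n) {m : ℕ} (hm : m < 2) {k : Fin n →₀ ℕ} (hk : k ∈ indices n m) :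
    coeff k (formalSeries lam v j) = 0 :=
  formalSeries_mem lam v j k (by rwa [mem_indices.1 hk])

/-- A geometric series of ratio `C₀ρ ≤ 1/2` starting at degree two. A single component is bounded by
the polynomial norm of the whole field, so `n` does not appear. -/
theorem wnorm_formalSeries_le {lam : Fin n → ℂ} {v : ℕ → Fin n → MvPolynomial (Fin n) ℂ}
    {A C₀ ρ : ℝ} (hA : 0 ≤ A) (hC : 0 ≤ C₀) (hρ : 0 ≤ ρ) (hCρ : C₀ * ρ ≤ 1 / 2)
    (hv : NonlinearBound lam v A C₀) (j : Fin n) :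
    wnorm (ENNReal.ofReal ρ) (formalSeries lam v j) ≤ ENNReal.ofReal (2 * A * ρ ^ 2) := by
  rw [wnorm_eq_tsum_indices, tsum_eq_zero_add' ENNReal.summable,
    tsum_eq_zero_add' ENNReal.summable]
  have h0 : ∀ m < 2, ∑ k ∈ indices n m, ‖coeff k (formalSeries lam v j)‖ₑ = 0 := fun m hm =>
    Finset.sum_eq_zero fun k hk => by rw [coeff_formalSeries_eq_zero lam v j hm hk, enorm_zero]
  rw [h0 0 (by norm_num), h0 (0 + 1) (by norm_num), zero_mul, zero_mul, zero_add, zero_add]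
  have hs : ∀ s, (∑ k ∈ indices n (s + 1 + 1), ‖coeff k (formalSeries lam v j)‖ₑ) *
      ENNReal.ofReal ρ ^ (s + 1 + 1) ≤ ENNReal.ofReal (A * ρ ^ 2 * (1 / 2) ^ s) := by
    intro s
    have h1 : ∑ k ∈ indices n (s + 1 + 1), ‖coeff k (formalSeries lam v j)‖ₑ ≤
        ENNReal.ofReal (A * C₀ ^ s) := by
      calc ∑ k ∈ indices n (s + 1 + 1), ‖coeff k (formalSeries lam v j)‖ₑ
          = ∑ k ∈ indices n (s + 1 + 1), ‖(invLinear lam (v (s + 1)) j).coeff k‖ₑ :=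
            Finset.sum_congr rfl fun k hk => by rw [coeff_formalSeries_of_mem lam v j hk]
        _ ≤ wnorm 1 (invLinear lam (v (s + 1)) j : MvPowerSeries (Fin n) ℂ) := by
            rw [wnorm]
            refine le_trans (le_of_eq (Finset.sum_congr rfl fun k _ => ?_))
              (ENNReal.sum_le_tsum (indices n (s + 1 + 1)))
            simp
        _ ≤ ∑ i, wnorm 1 (invLinear lam (v (s + 1)) i : MvPowerSeries (Fin n) ℂ) :=
            Finset.single_le_sum_of_canonicallyOrdered
              (f := fun i => wnorm 1 (invLinear lam (v (s + 1)) i : MvPowerSeries (Fin n) ℂ))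
              (Finset.mem_univ j)
        _ = ENNReal.ofReal (polyNorm (invLinear lam (v (s + 1)))) := (ofReal_polyNorm _).symm
        _ ≤ _ := ENNReal.ofReal_le_ofReal (hv (s + 1) (Nat.le_add_left 1 s))
    rw [← ENNReal.ofReal_pow hρ]
    refine (mul_le_mul_left h1 _).trans ?_
    rw [← ENNReal.ofReal_mul (by positivity)]
    refine ENNReal.ofReal_le_ofReal ?_
    calc A * C₀ ^ s * ρ ^ (s + 1 + 1) = A * ρ ^ 2 * (C₀ * ρ) ^ s := by ring
      _ ≤ _ := by gcongr
  refine (ENNReal.tsum_le_tsum hs).trans (le_of_eq ?_)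
  rw [← ENNReal.ofReal_tsum_of_nonneg (fun s => by positivity)
    (summable_geometric_two.mul_left _), tsum_mul_left, tsum_geometric_two]
  congr 1
  ring

theorem hasSum_evalAt_formalSeries {lam : Fin n → ℂ} {v : ℕ → Fin n → MvPolynomial (Fin n) ℂ}
    (hv : ∀ s : ℕ, 1 ≤ s → ∀ j, (v s j).IsHomogeneous (s + 1)) {x : Fin n → ℂ} {ρ : ℝ≥0∞}
    (hx : ∀ i, ‖x i‖ₑ ≤ ρ) {j : Fin n} (h : wnorm ρ (formalSeries lam v j) ≠ ⊤) :
    HasSum (fun s => (lam j)⁻¹ * MvPolynomial.eval x (v (s + 1) j))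
      (evalAt x (formalSeries lam v j)) := by
  have h1 := (hasSum_nat_add_iff' 2).2 (hasSum_indices (hasSum_evalAt hx h))
  have h0 : ∑ m ∈ range 2, ∑ k ∈ indices n m, coeff k (formalSeries lam v j) * monoAt x k = 0 :=
    Finset.sum_eq_zero fun m hm => Finset.sum_eq_zero fun k hk => by
      rw [coeff_formalSeries_eq_zero lam v j (Finset.mem_range.1 hm) hk, zero_mul]
  rw [h0, sub_zero] at h1
  refine (congrArg (fun F => HasSum F _) (funext fun s => ?_)).mpr h1
  rw [eval_eq_sum_indices (hv (s + 1) (Nat.le_add_left 1 s) j), Finset.mul_sum]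
  refine Finset.sum_congr rfl fun k hk => ?_
  rw [coeff_formalSeries_of_mem lam v j hk, invLinear, MvPolynomial.coeff_C_mul, mul_assoc]

/-- Near the origin the map is the value of its formal expansion. -/
theorem IsMapExpansion.eventually_eq {lam : Fin n → ℂ} (hlam : ∀ j, lam j ≠ 0)
    {v : ℕ → Fin n → MvPolynomial (Fin n) ℂ} {f : (Fin n → ℂ) → (Fin n → ℂ)}
    (hf : IsMapExpansion lam v f) {ρ : ℝ} (hρ : 0 < ρ)
    (h : ∀ j, wnorm (ENNReal.ofReal ρ) (formalSeries lam v j) ≠ ⊤) :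
    ∀ᶠ x in 𝓝 (0 : Fin n → ℂ),
      ∀ j, evalAt x (linMul lam (formalSeries lam v) j) = f x j := by
  filter_upwards [hf.hasSum, Metric.closedBall_mem_nhds (0 : Fin n → ℂ) hρ] with x hx hxρ j
  have hx' := fun i => enorm_le_of_mem_closedBall (mem_closedBall_zero_iff.1 hxρ) i
  have h1 := (hx j).mul_left (lam j)⁻¹
  have h2 := (hasSum_evalAt_formalSeries hf.homogeneous hx' (h j)).unique h1
  rw [linMul, evalAt_smul, nearId, evalAt_add hx' (by simp [wnorm_X]) (h j), evalAt_X, h2]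
  have := hlam j
  field_simp
  ring

/-- The homogeneous parts are the terms of the power series of the map. -/
theorem IsMapExpansion.eval_eq {lam : Fin n → ℂ} {v : ℕ → Fin n → MvPolynomial (Fin n) ℂ}
    {f : (Fin n → ℂ) → (Fin n → ℂ)} (hf : IsMapExpansion lam v f)
    {p : FormalMultilinearSeries ℂ (Fin n → ℂ) (Fin n → ℂ)} (hp : HasFPowerSeriesAt f p 0)
    {s : ℕ} (hs : 1 ≤ s) (j : Fin n) (x : Fin n → ℂ) :
    MvPolynomial.eval x (v s j) = p (s + 1) (fun _ => x) j := by
  have hlim : Tendsto (fun z : ℂ => z • x) (𝓝 0) (𝓝 0) := by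
    have : Continuous fun z : ℂ => z • x := by fun_prop
    simpa using this.tendsto 0
  -- Restriction to the complex line through `x` gives two one-variable power series for `z ↦
  -- f(zx)_j`, with coefficients `a` and `b`; uniqueness identifies them.
  set a : ℕ → ℂ := fun m => p m (fun _ => x) j
  set b : ℕ → ℂ := fun m => if m = 0 then 0 else if m = 1 then lam j * x j else
    MvPolynomial.eval x (v (m - 1) j) with hb
  have h1 : HasFPowerSeriesAt (fun z : ℂ => f (z • x) j)
      (FormalMultilinearSeries.ofScalars ℂ a) 0 := by
    rw [hasFPowerSeriesAt_iff]
    filter_upwards [hlim.eventually hp.eventually_hasSum] with z hz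
    rw [zero_add] at hz ⊢
    have := (Pi.hasSum.1 hz) j
    refine (congrArg (fun F => HasSum F _) (funext fun m => ?_)).mpr this
    rw [FormalMultilinearSeries.coeff_ofScalars,
      (p m).map_smul_univ (fun _ => z) (fun _ => x)]
    simp [a]
  have h2 : HasFPowerSeriesAt (fun z : ℂ => f (z • x) j)
      (FormalMultilinearSeries.ofScalars ℂ b) 0 := by
    rw [hasFPowerSeriesAt_iff]
    filter_upwards [hlim.eventually hf.hasSum] with z hz
    rw [zero_add, ← hasSum_nat_add_iff' 2]
    have e1 : (fun m => z ^ (m + 2) • (FormalMultilinearSeries.ofScalars ℂ b).coeff (m + 2)) =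
        fun s => MvPolynomial.eval (z • x) (v (s + 1) j) := by
      funext m
      rw [FormalMultilinearSeries.coeff_ofScalars, hb,
        eval_smul_eq (hf.homogeneous (m + 1) (Nat.le_add_left 1 m) j)]
      simp
    have e2 : ∑ m ∈ range 2, z ^ m • (FormalMultilinearSeries.ofScalars ℂ b).coeff m =
        lam j * (z • x) j := by
      rw [Finset.sum_range_succ, Finset.sum_range_one]
      simp only [FormalMultilinearSeries.coeff_ofScalars, hb]
      simp
      ring
    rw [e1, e2]
    exact hz j
  have h3 := congrArg (fun q => q.coeff (s + 1)) (h2.eq_formalMultilinearSeries h1)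
  simp only [FormalMultilinearSeries.coeff_ofScalars] at h3
  rw [hb] at h3
  simpa [Nat.one_le_iff_ne_zero.1 hs] using h3

theorem wnorm_sum_le {ι σ : Type*} {ρ : ℝ≥0∞} (s : Finset ι) (g : ι → MvPowerSeries σ ℂ) :
    wnorm ρ (∑ i ∈ s, g i) ≤ ∑ i ∈ s, wnorm ρ (g i) :=
  Finset.le_sum_of_subadditive _ wnorm_zero.le wnorm_add_le _ _

theorem wnorm_prod_le {ι σ : Type*} {ρ : ℝ≥0∞} (s : Finset ι) (g : ι → MvPowerSeries σ ℂ) :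
    wnorm ρ (∏ i ∈ s, g i) ≤ ∏ i ∈ s, wnorm ρ (g i) :=
  Finset.le_prod_of_submultiplicative _ wnorm_one.le wnorm_mul_le _ _

theorem coe_smul_polynomial (c : ℂ) (P : MvPolynomial (Fin n) ℂ) :
    ((c • P : MvPolynomial (Fin n) ℂ) : MvPowerSeries (Fin n) ℂ)
      = c • (P : MvPowerSeries (Fin n) ℂ) := by
  ext k
  simp

/-- The coefficients of a polynomial given by a multilinear map. -/
theorem wnorm_one_le_of_eval_eq {P : MvPolynomial (Fin n) ℂ} {m : ℕ}
    (M : ContinuousMultilinearMap ℂ (fun _ : Fin m => (Fin n → ℂ)) (Fin n → ℂ)) (j : Fin n)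
    (h : ∀ x, MvPolynomial.eval x P = M (fun _ => x) j) :
    wnorm 1 (P : MvPowerSeries (Fin n) ℂ) ≤ ENNReal.ofReal ((n : ℝ) ^ m * ‖M‖) := by
  classical
  -- Expanding the multilinear map in the standard basis gives `n ^ m` terms, each of norm at most
  -- `‖M‖`. Dependence on `n` is harmless here: it only affects the existence of some `A` and `C₀`.
  have hP : P = ∑ l : Fin m → Fin n,
      (M fun i => Pi.single (l i) (1 : ℂ)) j • ∏ i, MvPolynomial.X (l i) := by
    refine MvPolynomial.funext fun x => ?_
    rw [h]
    have hx : x = ∑ i, x i • (Pi.single i (1 : ℂ) : Fin n → ℂ) := by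
      funext i
      simp [Finset.sum_apply, Pi.single_apply]
    have e : M (fun _ => x) = ∑ l : Fin m → Fin n,
        (∏ i, x (l i)) • M fun i => Pi.single (l i) (1 : ℂ) := by
      conv_lhs => rw [hx]
      refine (M.toMultilinearMap.map_sum
        fun (_ : Fin m) i => x i • (Pi.single i (1 : ℂ) : Fin n → ℂ)).trans ?_
      exact Finset.sum_congr rfl fun l _ => M.map_smul_univ _ _
    rw [e, Finset.sum_apply, map_sum]
    refine Finset.sum_congr rfl fun l _ => ?_
    simp [MvPolynomial.smul_eval, map_prod, mul_comm]
  have hcoe : (P : MvPowerSeries (Fin n) ℂ) = ∑ l : Fin m → Fin n,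
      (M fun i => Pi.single (l i) (1 : ℂ)) j • ∏ i, (X (l i) : MvPowerSeries (Fin n) ℂ) := by
    conv_lhs => rw [hP]
    rw [← MvPolynomial.coeToMvPowerSeries.ringHom_apply, map_sum]
    refine Finset.sum_congr rfl fun l _ => ?_
    rw [MvPolynomial.coeToMvPowerSeries.ringHom_apply, coe_smul_polynomial,
      ← MvPolynomial.coeToMvPowerSeries.ringHom_apply, map_prod]
    simp
  rw [hcoe]
  refine (wnorm_sum_le _ _).trans ?_
  have hl : ∀ l : Fin m → Fin n, wnorm 1 ((M fun i => Pi.single (l i) (1 : ℂ)) j •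
      ∏ i, (X (l i) : MvPowerSeries (Fin n) ℂ)) ≤ ENNReal.ofReal ‖M‖ := by
    intro l
    rw [wnorm_smul]
    calc _ ≤ ‖(M fun i => Pi.single (l i) (1 : ℂ)) j‖ₑ *
          ∏ i, wnorm 1 (X (l i) : MvPowerSeries (Fin n) ℂ) := by
          gcongr
          exact wnorm_prod_le _ _
      _ = ‖(M fun i => Pi.single (l i) (1 : ℂ)) j‖ₑ := by simp [wnorm_X]
      _ ≤ _ := by
          rw [← ofReal_norm]
          refine ENNReal.ofReal_le_ofReal ((norm_le_pi_norm _ j).trans ?_)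
          refine (M.le_opNorm _).trans (le_of_eq ?_)
          simp [Pi.norm_single]
  refine (Finset.sum_le_sum fun l _ => hl l).trans (le_of_eq ?_)
  rw [Finset.sum_const, nsmul_eq_mul, ENNReal.ofReal_mul (by positivity), ENNReal.ofReal_pow
    (by positivity)]
  simp

/-- An analytic map has a nonlinearity of finite size. -/
theorem IsMapExpansion.exists_nonlinearBound {lam : Fin n → ℂ}
    {v : ℕ → Fin n → MvPolynomial (Fin n) ℂ}
    {f : (Fin n → ℂ) → (Fin n → ℂ)} (hf : IsMapExpansion lam v f) :
    ∃ A C₀ : ℝ, 0 < A ∧ 0 ≤ C₀ ∧ NonlinearBound lam v A C₀ := by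
  obtain ⟨p, hp⟩ := hf.analyticAt
  obtain ⟨C, r, hC, hr, hpr⟩ := p.le_mul_pow_of_radius_pos hp.radius_pos
  set K := ∑ j, ‖(lam j)⁻¹‖ with hK
  have hK0 : 0 ≤ K := Finset.sum_nonneg fun _ _ => norm_nonneg _
  -- The added `1` makes `A` positive even if `K = 0`.
  refine ⟨K * C * (n * r) ^ 2 + 1, n * r, by positivity, by positivity, fun s hs => ?_⟩
  have h1 : ENNReal.ofReal (polyNorm (invLinear lam (v s))) ≤
      ENNReal.ofReal (K * ((n : ℝ) ^ (s + 1) * (C * r ^ (s + 1)))) := by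
    rw [ofReal_polyNorm, hK, Finset.sum_mul, ENNReal.ofReal_sum_of_nonneg
      fun j _ => by positivity]
    refine Finset.sum_le_sum fun j _ => ?_
    rw [ENNReal.ofReal_mul (norm_nonneg _), ofReal_norm, invLinear, ← MvPolynomial.smul_eq_C_mul,
      coe_smul_polynomial, wnorm_smul]
    gcongr
    refine (wnorm_one_le_of_eval_eq (p (s + 1)) j fun x => hf.eval_eq hp hs j x).trans ?_
    refine ENNReal.ofReal_le_ofReal ?_
    gcongr
    exact hpr _
  have h2 := (ENNReal.ofReal_le_ofReal_iff (by positivity)).1 h1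
  obtain ⟨t, rfl⟩ := Nat.exists_eq_add_of_le' hs
  calc _ ≤ _ := h2
    _ = K * C * (n * r) ^ 2 * (n * r) ^ t := by ring
    _ ≤ _ := by
      rw [Nat.add_sub_cancel]
      gcongr
      linarith

end Expansion

/-! ### Properties of the divisor sequences -/

section Divisors

variable {n : ℕ} {lam : Fin n → ℂ}

theorem beta_nonneg (lam : Fin n → ℂ) (r : ℕ) : 0 ≤ beta lam r := by
  rw [beta]
  split_ifs
  · exact zero_le_one
  · exact Real.iInf_nonneg fun _ => norm_nonneg _

theorem beta_le {r : ℕ} (hr : 1 ≤ r) {k : Fin n →₀ ℕ} (hk : k.degree = r + 1) (j : Fin n) :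
    beta lam r ≤ ‖(∏ i, lam i ^ k i) * (lam j)⁻¹ - 1‖ := by
  rw [beta, if_neg (by omega)]
  exact ciInf_le (f := fun p : {k : Fin n → ℕ // ∑ i, k i = r + 1} × Fin n =>
    ‖(∏ i, lam i ^ p.1.1 i) * (lam p.2)⁻¹ - 1‖) ⟨0, by rintro _ ⟨p, rfl⟩; exact norm_nonneg _⟩
    (⟨k, by rw [← hk, Finsupp.degree_eq_sum]⟩, j)

theorem alpha_zero (lam : Fin n → ℂ) : alpha lam 0 = 1 := by
  simp [alpha, beta]

theorem alpha_pos (h : NonResonant lam) (r : ℕ) : 0 < alpha lam r := by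
  rw [alpha, Finset.lt_inf'_iff]
  intro s _
  rcases Nat.eq_zero_or_pos s with rfl | hs
  · simp [beta]
  · exact lt_of_le_of_ne (beta_nonneg lam s) (h s hs).symm

theorem alpha_antitone (lam : Fin n → ℂ) : Antitone (alpha lam) := fun _ _ h =>
  Finset.inf'_mono _ (Finset.range_mono (Nat.succ_le_succ h)) _

theorem alpha_le_beta (lam : Fin n → ℂ) (r : ℕ) : alpha lam r ≤ beta lam r :=
  Finset.inf'_le _ (Finset.self_mem_range_succ r)

end Divisors

/-! ### The analytic linearization -/

section Linearization

variable {n : ℕ}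

/-- The formal linearization yields an analytic one. -/
theorem exists_analytic_linearization {lam : Fin n → ℂ}
    {f : (Fin n → ℂ) → (Fin n → ℂ)} {u Φ : Fin n → MvPowerSeries (Fin n) ℂ}
    (hu : ∀ j, u j ∈ orderIdeal _ 2) {ρ R : ℝ} (hρ : 0 < ρ) (hR : 0 < R)
    (hun : ∀ j, wnorm (ENNReal.ofReal ρ) (u j) ≠ ⊤)
    (hf : ∀ᶠ x in 𝓝 (0 : Fin n → ℂ), ∀ j, evalAt x (linMul lam u j) = f x j)
    (hΦ : ∀ j, Φ j - X j ∈ orderIdeal _ 2)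
    (hconj : ∀ j, subst (linMul lam u) (Φ j) = lam j • Φ j)
    (hΦn : ∀ j, wnorm (ENNReal.ofReal R) (Φ j) ≠ ⊤) :
    ∃ ψ : (Fin n → ℂ) → (Fin n → ℂ), AnalyticOnNhd ℂ ψ (Metric.ball 0 R) ∧ ψ 0 = 0 ∧
      HasFDerivAt ψ (0 : (Fin n → ℂ) →L[ℂ] (Fin n → ℂ)) 0 ∧
      ∀ᶠ x in 𝓝 (0 : Fin n → ℂ), ∀ j, f x j + ψ (f x) j = lam j * (x j + ψ x j) := by
  have hF1 : ∀ j, linMul lam u j ∈ orderIdeal _ 1 := linMul_mem lam one_le_two hu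
  have hFn : ∀ j, wnorm (ENNReal.ofReal ρ) (linMul lam u j) ≠ ⊤ := fun j => by
    rw [linMul, wnorm_smul]
    refine ENNReal.mul_ne_top enorm_ne_top (ne_top_of_le_ne_top ?_ (wnorm_add_le _ _))
    rw [wnorm_X]
    exact ENNReal.add_ne_top.2 ⟨ENNReal.ofReal_ne_top, hun j⟩
  have hDn : ∀ j, wnorm (ENNReal.ofReal R) (Φ j - X j) ≠ ⊤ := fun j => by
    refine ne_top_of_le_ne_top ?_ (wnorm_sub_le _ _)
    rw [wnorm_X]
    exact ENNReal.add_ne_top.2 ⟨hΦn j, ENNReal.ofReal_ne_top⟩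
  set K : ℝ := ∑ j, (wnorm (ENNReal.ofReal R) (Φ j - X j)).toReal with hK
  -- A quadratic bound, from `Φ - X` having order two; it yields both `ψ 0 = 0` and the vanishing
  -- derivative.
  have hψ : ∀ x : Fin n → ℂ, ‖x‖ ≤ R →
      ‖fun j => evalAt x (Φ j) - x j‖ ≤ K / R ^ 2 * ‖x‖ ^ 2 := by
    intro x hx
    have hxR := fun i => enorm_le_of_mem_closedBall hx i
    refine (pi_norm_le_iff_of_nonneg (by positivity)).2 fun j => ?_
    have e : evalAt x (Φ j) - x j = evalAt x (Φ j - X j) := by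
      have := evalAt_add (x := x) hxR (hDn j) (g := X j) (by simp [wnorm_X])
      rw [sub_add_cancel, evalAt_X] at this
      rw [this, add_sub_cancel_right]
    have h1 : ‖evalAt x (Φ j - X j)‖ₑ ≤
        ENNReal.ofReal (‖x‖ / R) ^ 2 * wnorm (ENNReal.ofReal R) (Φ j - X j) := by
      refine (enorm_evalAt_le (fun i => enorm_le_of_mem_closedBall le_rfl i) _).trans ?_
      rw [show ENNReal.ofReal ‖x‖ = ENNReal.ofReal (‖x‖ / R) * ENNReal.ofReal R by
        rw [← ENNReal.ofReal_mul (by positivity), div_mul_cancel₀ _ hR.ne']]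
      exact wnorm_mul_radius_le (ENNReal.ofReal_le_one.2 ((div_le_one hR).2 hx)) (hΦ j)
    have h2 := ENNReal.toReal_mono (ENNReal.mul_ne_top (ENNReal.pow_ne_top ENNReal.ofReal_ne_top)
      (hDn j)) h1
    rw [toReal_enorm, ENNReal.toReal_mul, ENNReal.toReal_pow,
      ENNReal.toReal_ofReal (by positivity)] at h2
    rw [e]
    refine h2.trans ?_
    calc _ ≤ (‖x‖ / R) ^ 2 * K := by
          gcongr
          exact Finset.single_le_sum
            (f := fun j => (wnorm (ENNReal.ofReal R) (Φ j - X j)).toReal)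
            (fun _ _ => ENNReal.toReal_nonneg) (Finset.mem_univ j)
      _ = _ := by ring
  refine ⟨fun x j => evalAt x (Φ j) - x j, ?_, ?_, ?_, ?_⟩
  · refine (analyticOnNhd_pi_iff (f := fun j x => evalAt x (Φ j) - x j)).2 fun j => ?_
    have h1 := analyticOnNhd_evalAt (r := R.toNNReal) (by simpa using hR) (hΦn j)
    rw [Real.coe_toNNReal R hR.le] at h1
    exact h1.sub ((ContinuousLinearMap.proj (R := ℂ) (φ := fun _ : Fin n => ℂ) j).analyticOnNhd _)
  · have := hψ 0 (by simpa using hR.le)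
    simpa using this
  · refine Asymptotics.IsBigO.hasFDerivAt (n := 2) ?_ one_lt_two
    refine Asymptotics.IsBigO.of_bound (K / R ^ 2) ?_
    filter_upwards [Metric.closedBall_mem_nhds (0 : Fin n → ℂ) hR] with x hx
    simpa using hψ x (mem_closedBall_zero_iff.1 hx)
  · set L : ℝ := ∑ j, (wnorm (ENNReal.ofReal ρ) (linMul lam u j)).toReal with hL
    have hL0 : 0 ≤ L := Finset.sum_nonneg fun _ _ => ENNReal.toReal_nonneg
    -- The radius is shrunk until the map sends the polydisk of radius `tρ` into the one of radius
    -- `R`, where `Φ` can be composed with it; order one of the map gives the factor `t`.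
    set t : ℝ := min 1 (R / (L + 1)) with ht
    have htpos : 0 < t := lt_min one_pos (by positivity)
    have hle : ∀ j, wnorm (ENNReal.ofReal (t * ρ)) (linMul lam u j) ≤ ENNReal.ofReal R := by
      intro j
      rw [ENNReal.ofReal_mul htpos.le]
      refine (wnorm_mul_radius_le (ENNReal.ofReal_le_one.2 (min_le_left _ _)) (hF1 j)).trans ?_
      rw [pow_one, ← ENNReal.ofReal_toReal (hFn j), ← ENNReal.ofReal_mul htpos.le]
      refine ENNReal.ofReal_le_ofReal ?_
      have h1 : (wnorm (ENNReal.ofReal ρ) (linMul lam u j)).toReal ≤ L :=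
        Finset.single_le_sum (f := fun j => (wnorm (ENNReal.ofReal ρ) (linMul lam u j)).toReal)
          (fun _ _ => ENNReal.toReal_nonneg) (Finset.mem_univ j)
      calc _ ≤ R / (L + 1) * (L + 1) := by
            gcongr
            · exact min_le_right _ _
            · linarith
        _ = R := div_mul_cancel₀ _ (by positivity)
    filter_upwards [hf, Metric.closedBall_mem_nhds (0 : Fin n → ℂ) (mul_pos htpos hρ)]
      with x hx hxt j
    have hx' := fun i => enorm_le_of_mem_closedBall (mem_closedBall_zero_iff.1 hxt) i
    have h1 := evalAt_subst hx' ENNReal.ofReal_ne_top hle hF1 (hΦn j)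
    rw [hconj, evalAt_smul, funext hx] at h1
    rw [add_sub_cancel, add_sub_cancel, h1]

end Linearization

end SchroederSiegel

/-! ### The main theorem -/

theorem mainTheorem1 :
    ∃ B : ℝ → ℝ → ℝ, (∀ A C₀ : ℝ, 0 < B A C₀) ∧
      ∀ (n : ℕ), 1 ≤ n →
      ∀ (lam : Fin n → ℂ), (∀ j, lam j ≠ 0) → SchroederSiegel.NonResonant lam →
      ∀ (Γ : ℝ), SchroederSiegel.ConditionTau lam Γ →
      ∀ (v : ℕ → Fin n → MvPolynomial (Fin n) ℂ) (f : (Fin n → ℂ) → (Fin n → ℂ)),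
        SchroederSiegel.IsMapExpansion lam v f →
        (∃ A C₀ : ℝ, 0 < A ∧ 0 ≤ C₀ ∧ SchroederSiegel.NonlinearBound lam v A C₀) ∧
        ∀ (A C₀ : ℝ), 0 < A → 0 ≤ C₀ → SchroederSiegel.NonlinearBound lam v A C₀ →
          ∃ ψ : (Fin n → ℂ) → (Fin n → ℂ),
            AnalyticOnNhd ℂ ψ
              (SchroederSiegel.polydisk n ((B A C₀)⁻¹ * Real.exp (-Γ))) ∧
            ψ 0 = 0 ∧ HasFDerivAt ψ (0 : (Fin n → ℂ) →L[ℂ] (Fin n → ℂ)) 0 ∧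
            (∀ᶠ x in 𝓝 (0 : Fin n → ℂ), ∀ j,
              f x j + ψ (f x) j = lam j * (x j + ψ x j)) ∧
            ((-Γ + -Real.log (B A C₀) : ℝ) : EReal) ≤
              ENNReal.log (SchroederSiegel.analyticRadius ψ) := by
  -- `e^8` is the loss not due to divisors. One factor `2` leaves room for the growth of `Φ`; the
  -- other places the closed polydisk inside the open ball of analyticity. The absolute values make
  -- `B` positive for all real arguments.
  refine ⟨fun A C₀ => 4 * Real.exp 8 * (2 * |C₀| + 32 * |A| + 1), fun A C₀ => by positivity, ?_⟩
  intro n _ lam hlam hres Γ hΓ v f hf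
  refine ⟨hf.exists_nonlinearBound, fun A C₀ hA hC hv => ?_⟩
  simp only [abs_of_pos hA, abs_of_nonneg hC]
  -- The initial radius is `1/D`: the term `2C₀` gives the geometric ratio `1/2`, and `32A` gives
  -- the starting size `ρ₀/16`.
  set D := 2 * C₀ + 32 * A + 1 with hD
  have hDpos : 0 < D := by positivity
  have hρ : 0 < D⁻¹ := inv_pos.2 hDpos
  have hCρ : C₀ * D⁻¹ ≤ 1 / 2 := by
    rw [← div_eq_mul_inv, div_le_iff₀ hDpos]
    linarith
  have hAρ : 2 * A * D⁻¹ ^ 2 ≤ D⁻¹ / 16 := by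
    have : A * D⁻¹ ≤ 1 / 32 := by
      rw [← div_eq_mul_inv, div_le_iff₀ hDpos]
      linarith
    calc 2 * A * D⁻¹ ^ 2 = 2 * (A * D⁻¹) * D⁻¹ := by ring
      _ ≤ 2 * (1 / 32) * D⁻¹ := by gcongr
      _ = _ := by ring
  have hn := SchroederSiegel.wnorm_formalSeries_le hA.le hC hρ.le hCρ hv
  have hmem := SchroederSiegel.formalSeries_mem lam v
  obtain ⟨Φ, hΦ, hconj, hΦn⟩ := SchroederSiegel.exists_formal_linearization hlam
    (SchroederSiegel.alpha_zero lam) (SchroederSiegel.alpha_pos hres)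
    (SchroederSiegel.alpha_antitone lam)
    (fun r hr k j hk => (SchroederSiegel.alpha_le_beta lam r).trans
      (SchroederSiegel.beta_le hr hk j)) hΓ hρ hmem
    (fun j => (hn j).trans (ENNReal.ofReal_le_ofReal hAρ))
  have hntop := fun j => ne_top_of_le_ne_top ENNReal.ofReal_ne_top (hn j)
  have hR : 0 < D⁻¹ * Real.exp (-8) * Real.exp (-Γ) / 2 := by positivity
  obtain ⟨ψ, hψ, h0, hd, hc⟩ := SchroederSiegel.exists_analytic_linearization hmem hρ hR hntop
    (hf.eventually_eq hlam hρ hntop) hΦ hconj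
    (fun j => ne_top_of_le_ne_top ENNReal.ofReal_ne_top (hΦn j))
  have hBpos : 0 < (4 * Real.exp 8 * D)⁻¹ * Real.exp (-Γ) := by positivity
  have hBR : (4 * Real.exp 8 * D)⁻¹ * Real.exp (-Γ) <
      D⁻¹ * Real.exp (-8) * Real.exp (-Γ) / 2 := by
    rw [Real.exp_neg 8, mul_inv, mul_inv]
    have : 0 < D⁻¹ * (Real.exp 8)⁻¹ * Real.exp (-Γ) := by positivity
    linarith
  have han : AnalyticOnNhd ℂ ψ
      (SchroederSiegel.polydisk n ((4 * Real.exp 8 * D)⁻¹ * Real.exp (-Γ))) :=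
    hψ.mono fun x hx => mem_ball_zero_iff.2
      (((pi_norm_le_iff_of_nonneg hBpos.le).2 hx).trans_lt hBR)
  refine ⟨ψ, han, h0, hd, hc, ?_⟩
  have hle : ENNReal.ofReal ((4 * Real.exp 8 * D)⁻¹ * Real.exp (-Γ)) ≤
      SchroederSiegel.analyticRadius ψ :=
    le_iSup₂_of_le ((4 * Real.exp 8 * D)⁻¹ * Real.exp (-Γ)).toNNReal
      (by rwa [Real.coe_toNNReal _ hBpos.le]) le_rfl
  refine le_trans (le_of_eq ?_) (ENNReal.log_monotone hle)
  rw [ENNReal.log_ofReal_of_pos hBpos,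
    Real.log_mul (inv_pos.2 (by positivity)).ne' (Real.exp_pos (-Γ)).ne', Real.log_exp (-Γ),
    Real.log_inv, add_comm]
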